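/- **Setting.** Let $\mathcal S=\{1,\dots,S\}$ and $\mathcal A=\{1,\dots,A\}$ be nonempty finite sets of states and actions, $R:\mathcal S\times\mathcal A\times\mathcal S\to\mathbb R$ a reward function with $r_{s,a}=R(s,a,\cdot)\in\mathbb R^S$, $p_0$ an initial distribution on $\mathcal S$, and $\gamma\in[0,1)$. A transition function $P=(p_{s,a})_{s,a}$ assigns a probability vector $p_{s,a}\in\Delta^S$ to every $(s,a)$; a policy $\pi\in\Pi$ assigns a distribution $\pi(s)$ on $\mathcal A$ to every state $s$. Let $\rho(\pi,P)=\mathbb E\big[\sum_{t\ge0}\gamma^tR(s_t,a_t,s_{t+1})\big]$, where $s_0\sim p_0$, $a_t\sim\pi(s_t)$, $s_{t+1}\sim p_{s_t,a_t}$. For a real random variable $X$ let $\mathrm{VaR}_\alpha[X]=\sup\{t\in\mathbb R:\Pr[X\ge t]\ge1-\alpha\}$. Let $\Phi$ be the standard normal distribution function. For $N\in\mathbb N$ let $\tilde P_N$ be a random transition function (distributed according to the posterior after $N$ observations), and let $P^*$ be the true transition function. Assume that the posterior is asymptotically normal: $$\sqrt N\,(\tilde P_N-P^*)\rightsquigarrow\mathcal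 N(0,\Sigma)\qquad(N\to\infty)$$ jointly in all coordinates $(s,a,s')$, where $\Sigma$ is a positive semidefinite, possibly singular, matrix (the inverse Fisher information at $P^*$); let $\Sigma_{s,a}\in\mathbb R^{S\times S}$ be its diagonal block for $(s,a)$. Let $\delta\in(0,\tfrac12)$ and $\alpha=\delta/S$. Let $\rho^*_N=\max_{\pi\in\Pi}\mathrm{VaR}_\delta[\rho(\pi,\tilde P_N)]$ be the optimal percentile return. Let $\hat v_N\in\mathbb R^S$ be the fixed point of the VaR Bellman operator $$(\mathcal T_Nv)_s=\max_{a\in\mathcal A}\mathrm{VaR}_\alpha\big[\tilde p_{N,s,a}^{\top}(r_{s,a}+\gamma v)\big],$$ and put $\hat\rho_N=p_0^\top\hat v_N$, $\hat w_{N,s,a}=r_{s,a}+\gamma\hat v_N$ and $\sigma_{\max,N}^2=\max_{s,a}\hat w_{N,s,a}^\top\Sigma_{s,a}\hat w_{N,s,a}$. **Theorem (Asymptotic Performance).** For every $N$ the fixed point $\hat v_N$ exists and is unique, the limits $\sigma_{\max}=\lim_{N\to\infty}\sigma_{\max,N}$ and $\lim_{N\to\infty}\sqrt N(\rho^*_N-\hat\rho_N)$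 exist in $\mathbb R$, and $$\lim_{N\to\infty}\sqrt N\,(\rho^*_N-\hat\rho_N)\;\le\;\frac{2\,\Phi^{-1}(1-\delta/S)\,\sigma_{\max}}{1-\gamma}\;\le\;\frac{\sqrt{8\ln(S/\delta)}\,\sigma_{\max}}{1-\gamma}.$$ -/

import Mathlib

open MeasureTheory ProbabilityTheory Filter Topology
open scoped Matrix

noncomputable section

/-- Transition functions `(s, a) ↦ p_{s,a}` with values in the probability simplex. -/
abbrev Transition (S A : ℕ) : Type := Fin S → Fin A → stdSimplex ℝ (Fin S)

/-- Markovian (stationary, randomized) policies. -/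
abbrev Policy (S A : ℕ) : Type := Fin S → stdSimplex ℝ (Fin A)

/-- The measure on `Fin n` whose point masses are the coordinates of `p`. -/
def simplexMeasure {n : ℕ} (p : stdSimplex ℝ (Fin n)) : Measure (Fin n) :=
  ∑ i, ENNReal.ofReal (p i) • Measure.dirac i

instance {n : ℕ} (p : stdSimplex ℝ (Fin n)) : IsProbabilityMeasure (simplexMeasure p) where
  measure_univ := by
    have h : ∑ i, p.1 i = 1 := p.2.2
    have h' : ∑ i, ENNReal.ofReal (p.1 i) = 1 := by
      rw [← ENNReal.ofReal_sum_of_nonneg (fun i _ => p.2.1 i), h, ENNReal.ofReal_one]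
    simp only [simplexMeasure, Measure.finsetSum_apply, Measure.smul_apply, measure_univ,
      smul_eq_mul, mul_one]
    exact h'

/-- The policy as a Markov kernel from states to actions. -/
def policyKernel {S A : ℕ} (π : Policy S A) : Kernel (Fin S) (Fin A) :=
  Kernel.ofFunOfCountable fun s => simplexMeasure (π s)

instance {S A : ℕ} (π : Policy S A) : IsMarkovKernel (policyKernel π) where
  isProbabilityMeasure s := inferInstanceAs (IsProbabilityMeasure (simplexMeasure (π s)))

/-- One step `(s, a) ↦ (s', a')` of the controlled chain: `s' ∼ p_{s,a}`, then `a' ∼ π(s')`. -/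
def stepKernel {S A : ℕ} (π : Policy S A) (P : Transition S A) :
    Kernel (Fin S × Fin A) (Fin S × Fin A) :=
  Kernel.ofFunOfCountable fun x => simplexMeasure (P x.1 x.2) ⊗ₘ policyKernel π

instance {S A : ℕ} (π : Policy S A) (P : Transition S A) : IsMarkovKernel (stepKernel π P) where
  isProbabilityMeasure x :=
    inferInstanceAs (IsProbabilityMeasure (simplexMeasure (P x.1 x.2) ⊗ₘ policyKernel π))

/-- The step from time `n` to time `n + 1` as a kernel on histories up to time `n`; it depends on
the history only through its last entry. -/
def historyKernel {S A : ℕ} (π : Policy S A) (P : Transition S A) (n : ℕ) :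
    Kernel (Finset.Iic n → Fin S × Fin A) (Fin S × Fin A) :=
  (stepKernel π P).comap (fun h => h ⟨n, Finset.mem_Iic.2 le_rfl⟩) (measurable_pi_apply _)

instance {S A : ℕ} (π : Policy S A) (P : Transition S A) (n : ℕ) :
    IsMarkovKernel (historyKernel π P n) :=
  inferInstanceAs (IsMarkovKernel ((stepKernel π P).comap _ _))

/-- The law of the trajectory `((s_t, a_t))_t` with `s_0 ∼ p₀`, `a_t ∼ π(s_t)` and
`s_{t+1} ∼ P(s_t, a_t, ·)`. -/
def trajectoryLaw {S A : ℕ} (p₀ : stdSimplex ℝ (Fin S)) (π : Policy S A) (P : Transition S A) :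
    Measure (ℕ → Fin S × Fin A) :=
  Kernel.trajMeasure (X := fun _ => Fin S × Fin A)
    (simplexMeasure p₀ ⊗ₘ policyKernel π) (historyKernel π P)

/-- The expected discounted return `ρ(π, P)`. -/
def expectedReturn {S A : ℕ} (R : Fin S → Fin A → Fin S → ℝ) (p₀ : stdSimplex ℝ (Fin S)) (γ : ℝ)
    (π : Policy S A) (P : Transition S A) : ℝ :=
  ∫ ω, ∑' t : ℕ, γ ^ t * R (ω t).1 (ω t).2 (ω (t + 1)).1 ∂(trajectoryLaw p₀ π P)

/-- Value at risk: `VaR_α[X] = sup {t | Pr[X ≥ t] ≥ 1 - α}`. -/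
def valueAtRisk {Ω : Type*} [MeasurableSpace Ω] (μ : Measure Ω) (α : ℝ) (X : Ω → ℝ) : ℝ :=
  sSup {t : ℝ | 1 - α ≤ μ.real {ω | t ≤ X ω}}

/-- `w_{s,a} = r_{s,a} + γ v`. -/
def oneStepValue {S A : ℕ} (R : Fin S → Fin A → Fin S → ℝ) (γ : ℝ) (v : Fin S → ℝ)
    (s : Fin S) (a : Fin A) : Fin S → ℝ :=
  R s a + γ • v

/-- The VaR Bellman optimality operator
`(T v)_s = max_a VaR_α[p̃_{s,a}ᵀ (r_{s,a} + γ v)]`, where `P̃` has law `μ`. -/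
def varBellman {S A : ℕ} (R : Fin S → Fin A → Fin S → ℝ) (γ : ℝ) (μ : Measure (Transition S A))
    (α : ℝ) (v : Fin S → ℝ) : Fin S → ℝ :=
  fun s => ⨆ a : Fin A,
    valueAtRisk μ α fun P : Transition S A => (P s a : Fin S → ℝ) ⬝ᵥ oneStepValue R γ v s a

/-- The optimal percentile return `ρ* = max_π VaR_δ[ρ(π, P̃)]`, where `P̃` has law `μ`. -/
def optimalPercentileReturn {S A : ℕ} (R : Fin S → Fin A → Fin S → ℝ)
    (p₀ : stdSimplex ℝ (Fin S)) (γ : ℝ) (μ : Measure (Transition S A)) (δ : ℝ) : ℝ :=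
  ⨆ π : Policy S A, valueAtRisk μ δ (expectedReturn R p₀ γ π)

/-- The rescaled deviation `√N (P - P*)`, as a vector indexed by `(s, a, s')`. -/
def scaledDeviation {S A : ℕ} (Pstar : Transition S A) (N : ℕ) (P : Transition S A) :
    EuclideanSpace ℝ (Fin S × Fin A × Fin S) :=
  WithLp.toLp 2 fun x => √(N : ℝ) * (P x.1 x.2.1 x.2.2 - Pstar x.1 x.2.1 x.2.2)

/-- The block of a covariance matrix that belongs to the transition vector of `(s, a)`. -/
def covBlock {S A : ℕ} (C : Matrix (Fin S × Fin A × Fin S) (Fin S × Fin A × Fin S) ℝ)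
    (s : Fin S) (a : Fin A) : Matrix (Fin S) (Fin S) ℝ :=
  C.submatrix (fun s' => (s, a, s')) (fun s' => (s, a, s'))

/-- The square root of `max_{s,a} w_{s,a}ᵀ C_{s,a} w_{s,a}`, where `w_{s,a} = r_{s,a} + γ v`. -/
def sigmaMax {S A : ℕ} (R : Fin S → Fin A → Fin S → ℝ) (γ : ℝ)
    (C : Matrix (Fin S × Fin A × Fin S) (Fin S × Fin A × Fin S) ℝ) (v : Fin S → ℝ) : ℝ :=
  √(⨆ x : Fin S × Fin A,
    oneStepValue R γ v x.1 x.2 ⬝ᵥ (covBlock C x.1 x.2 *ᵥ oneStepValue R γ v x.1 x.2))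

/-- The quantile function `Φ⁻¹` of the standard normal distribution. -/
def stdNormalQuantile (q : ℝ) : ℝ :=
  sInf {x : ℝ | q ≤ cdf (gaussianReal 0 1) x}

end

/-!
Write `Δ_N = √N (P̃_N - P*)` and let `v*` be the optimal value function of `P*`. If `X` is
asymptotically linear, `√N (X(P̃_N) - X(P*)) ≈ ⟨c, Δ_N⟩`, then `√N (VaR_α X - X(P*))` converges to
the corresponding quantile of `⟨c, 𝒩(0, Σ)⟩`, namely `-Φ⁻¹(1 - α) √(cᵀ Σ c)`.

For the returns, the performance difference identity
`ρ(π, P) - ρ(π, P*) = ∑_{s,a} d(s) π(a|s) (p_{s,a} - p*_{s,a})ᵀ (r_{s,a} + γ v_{π,P})`, with `d` the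
discounted occupancy of `π` under `P*`, gives the slope `c`, which is continuous in `π`. In the
scaled maximum over policies the suboptimality of `π` under `P*` acts as a penalty of order `√N`, so
only the policies that are optimal for `P*` survive in the limit: `√N (ρ*_N - p₀ᵀ v*)` converges,
and to a nonpositive limit, since `Φ⁻¹(1 - δ) ≥ 0`.

In the same way `√N (v̂_N - v*)` is the fixed point of a penalized Bellman operator and converges to
the fixed point of `u ↦ max_a (-Φ⁻¹(1 - α) √(wᵀ Σ_{s,a} w) + γ p*_{s,a}ᵀ u)`, the maximum being over
the optimal actions. That fixed point is at least `-Φ⁻¹(1 - α) σ_max / (1 - γ)`.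
-/

/-! ### Value at risk -/

section ValueAtRisk

variable {Ω : Type*} [MeasurableSpace Ω] {μ : Measure Ω} {α : ℝ} {X Y : Ω → ℝ}

theorem mem_upperBounds_of_measureReal_lt [IsFiniteMeasure μ] {b : ℝ}
    (hb : μ.real {ω | b ≤ X ω} < 1 - α) :
    b ∈ upperBounds {t : ℝ | 1 - α ≤ μ.real {ω | t ≤ X ω}} := by
  intro t (ht : 1 - α ≤ μ.real {ω | t ≤ X ω})
  by_contra! hbt
  exact (ht.trans (measureReal_mono fun ω hω => hbt.le.trans hω)).not_gt hb

theorem valueAtRisk_mem_Icc [IsFiniteMeasure μ] {a b : ℝ}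
    (ha : 1 - α ≤ μ.real {ω | a ≤ X ω}) (hb : μ.real {ω | b ≤ X ω} < 1 - α) :
    valueAtRisk μ α X ∈ Set.Icc a b :=
  ⟨le_csSup ⟨b, mem_upperBounds_of_measureReal_lt hb⟩ ha,
    csSup_le ⟨a, ha⟩ (mem_upperBounds_of_measureReal_lt hb)⟩

theorem mul_valueAtRisk_sub_mem_Icc [IsFiniteMeasure μ] {k b x y : ℝ} (hk : 0 < k)
    (hx : 1 - α ≤ μ.real {ω | x ≤ k * (X ω - b)}) (hy : μ.real {ω | y ≤ k * (X ω - b)} < 1 - α) :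
    k * (valueAtRisk μ α X - b) ∈ Set.Icc x y := by
  have hiff (t z : ℝ) : t ≤ k * (z - b) ↔ b + t / k ≤ z := by
    rw [← div_le_iff₀' hk, le_sub_iff_add_le']
  simp only [hiff] at hx hy
  obtain ⟨hlow, hupp⟩ := valueAtRisk_mem_Icc hx hy
  refine ⟨(hiff _ _).2 hlow, ?_⟩
  rwa [← le_div_iff₀' hk, sub_le_iff_le_add']

theorem nonempty_valueAtRisk_levels [IsProbabilityMeasure μ] (hα : 0 ≤ α)
    (hX : BddBelow (Set.range X)) : {t : ℝ | 1 - α ≤ μ.real {ω | t ≤ X ω}}.Nonempty := by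
  obtain ⟨a, ha⟩ := hX
  have hall : {ω | a ≤ X ω} = Set.univ := Set.eq_univ_of_forall fun ω => ha ⟨ω, rfl⟩
  exact ⟨a, by simpa [hall] using hα⟩

theorem le_of_mem_valueAtRisk_levels (hα : α < 1) {b t : ℝ} (hX : ∀ ω, X ω ≤ b)
    (ht : 1 - α ≤ μ.real {ω | t ≤ X ω}) : t ≤ b := by
  by_contra! hbt
  have hempty : {ω | t ≤ X ω} = ∅ :=
    Set.eq_empty_of_forall_notMem fun ω => ((hX ω).trans_lt hbt).not_ge
  rw [hempty, measureReal_empty] at ht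
  linarith

theorem valueAtRisk_le [IsProbabilityMeasure μ] (hα0 : 0 ≤ α) (hα1 : α < 1) {b : ℝ}
    (hX : BddBelow (Set.range X)) (hXb : ∀ ω, X ω ≤ b) : valueAtRisk μ α X ≤ b :=
  csSup_le (nonempty_valueAtRisk_levels hα0 hX) fun _ => le_of_mem_valueAtRisk_levels hα1 hXb

theorem valueAtRisk_le_add [IsProbabilityMeasure μ] (hα0 : 0 ≤ α) (hα1 : α < 1) {c : ℝ}
    (hX : BddBelow (Set.range X)) (hY : BddAbove (Set.range Y)) (hXY : ∀ ω, X ω ≤ Y ω + c) :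
    valueAtRisk μ α X ≤ valueAtRisk μ α Y + c := by
  obtain ⟨b, hb⟩ := hY
  refine csSup_le (nonempty_valueAtRisk_levels hα0 hX) fun t ht => ?_
  rw [← sub_le_iff_le_add]
  refine le_csSup ⟨b, fun _ => le_of_mem_valueAtRisk_levels hα1 fun ω => hb ⟨ω, rfl⟩⟩ ?_
  exact ht.trans (measureReal_mono fun ω hω => sub_le_iff_le_add.2 (le_trans hω (hXY ω)))

theorem dist_valueAtRisk_le [IsProbabilityMeasure μ] (hα0 : 0 ≤ α) (hα1 : α < 1) {c : ℝ}
    (hX : Bornology.IsBounded (Set.range X)) (hY : Bornology.IsBounded (Set.range Y))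
    (hXY : ∀ ω, dist (X ω) (Y ω) ≤ c) : dist (valueAtRisk μ α X) (valueAtRisk μ α Y) ≤ c := by
  simp only [Real.dist_eq, abs_sub_le_iff, sub_le_iff_le_add'] at hXY ⊢
  exact ⟨valueAtRisk_le_add hα0 hα1 hX.bddBelow hY.bddAbove fun ω => (hXY ω).1,
    valueAtRisk_le_add hα0 hα1 hY.bddBelow hX.bddAbove fun ω => (hXY ω).2⟩

end ValueAtRisk

/-! ### Quantiles of normal distributions -/

section NormalQuantile

theorem strictMono_cdf_gaussianReal (m : ℝ) {v : NNReal} (hv : v ≠ 0) :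
    StrictMono (cdf (gaussianReal m v)) := by
  intro x y hxy
  have hpos : 0 < (gaussianReal m v).real (Set.Ioc x y) := by
    refine ENNReal.toReal_pos (fun h => ?_) (measure_ne_top _ _)
    have hvol := gaussianReal_absolutelyContinuous' m hv h
    rw [Real.volume_Ioc, ENNReal.ofReal_eq_zero] at hvol
    linarith
  rw [cdf_eq_real, cdf_eq_real, ← Set.Iic_union_Ioc_eq_Iic hxy.le,
    measureReal_union (Set.Iic_disjoint_Ioc le_rfl) measurableSet_Ioc]
  linarith

theorem gaussianReal_zero_real_Ici {v : NNReal} (hv : v ≠ 0) (x : ℝ) :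
    (gaussianReal 0 v).real (Set.Ici x) = cdf (gaussianReal 0 1) (-x / √v) := by
  have hv0 : 0 < √(v : ℝ) := Real.sqrt_pos.2 (NNReal.coe_pos.2 (pos_iff_ne_zero.2 hv))
  have hsymm : gaussianReal 0 v = (gaussianReal 0 1).map (-√v * ·) := by
    rw [gaussianReal_map_const_mul, mul_zero, mul_one]
    congr 1
    ext
    simp
  rw [hsymm, map_measureReal_apply (by fun_prop) measurableSet_Ici, cdf_eq_real]
  congr 1
  ext y
  simp only [Set.mem_preimage, Set.mem_Ici, Set.mem_Iic]
  rw [le_div_iff₀ hv0]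
  constructor <;> intro h <;> linarith

theorem cdf_lt_of_lt_stdNormalQuantile {q x : ℝ} (hq : 0 < q) (hx : x < stdNormalQuantile q) :
    cdf (gaussianReal 0 1) x < q := by
  by_contra! hqx
  obtain ⟨y, hy⟩ :=
    ((tendsto_cdf_atBot (gaussianReal 0 1)).eventually_lt_const hq).exists
  have hbdd : BddBelow {x : ℝ | q ≤ cdf (gaussianReal 0 1) x} :=
    ⟨y, fun z hz => ((strictMono_cdf_gaussianReal 0 one_ne_zero).lt_iff_lt.1 (hy.trans_le hz)).le⟩
  exact (csInf_le hbdd hqx).not_gt hx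

theorem lt_cdf_of_stdNormalQuantile_lt {q x : ℝ} (hq : q < 1) (hx : stdNormalQuantile q < x) :
    q < cdf (gaussianReal 0 1) x := by
  obtain ⟨y, hy⟩ := ((tendsto_cdf_atTop (gaussianReal 0 1)).eventually_const_lt hq).exists
  obtain ⟨z, hz, hzx⟩ := exists_lt_of_csInf_lt (s := {x : ℝ | q ≤ cdf (gaussianReal 0 1) x})
    ⟨y, hy.le⟩ hx
  exact hz.trans_lt (strictMono_cdf_gaussianReal 0 one_ne_zero hzx)

theorem cdf_stdNormal_add_cdf_neg (x : ℝ) :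
    cdf (gaussianReal 0 1) x + cdf (gaussianReal 0 1) (-x) = 1 := by
  have : NullSingletonClass (gaussianReal 0 1) := nullSingletonClass_gaussianReal one_ne_zero
  have hneg : cdf (gaussianReal 0 1) (-x) = (gaussianReal 0 1).real (Set.Ioi x) := by
    rw [measureReal_congr Ioi_ae_eq_Ici, gaussianReal_zero_real_Ici one_ne_zero]
    simp
  rw [hneg, cdf_eq_real, ← Set.compl_Iic, probReal_add_probReal_compl measurableSet_Iic]

theorem stdNormalQuantile_nonneg {q : ℝ} (hq : 1 / 2 ≤ q) : 0 ≤ stdNormalQuantile q := by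
  refine Real.sInf_nonneg fun x hx => ?_
  by_contra! hx0
  have hlt := strictMono_cdf_gaussianReal 0 one_ne_zero (show x < -x by linarith)
  have hsum := cdf_stdNormal_add_cdf_neg x
  have hqx : q ≤ cdf (gaussianReal 0 1) x := hx
  linarith

theorem one_sub_exp_le_cdf_stdNormal {x : ℝ} (hx : 0 ≤ x) :
    1 - Real.exp (-x ^ 2 / 2) ≤ cdf (gaussianReal 0 1) x := by
  have hchernoff := measure_ge_le_exp_mul_mgf (μ := gaussianReal 0 1) (X := id) x hx
    (integrable_exp_mul_gaussianReal x)
  have htail : cdf (gaussianReal 0 1) (-x) ≤ Real.exp (-x ^ 2 / 2) := by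
    rw [mgf_id_gaussianReal, ← Real.exp_add] at hchernoff
    have hIci := gaussianReal_zero_real_Ici one_ne_zero x
    rw [NNReal.coe_one, Real.sqrt_one, div_one] at hIci
    rw [← hIci]
    refine hchernoff.trans_eq (congrArg Real.exp ?_)
    rw [NNReal.coe_one]
    ring
  linarith [cdf_stdNormal_add_cdf_neg x]

theorem stdNormalQuantile_le_sqrt_log {α : ℝ} (hα0 : 0 < α) (hα1 : α < 1) :
    stdNormalQuantile (1 - α) ≤ √(2 * Real.log (1 / α)) := by
  by_contra! hlt
  have hcdf := cdf_lt_of_lt_stdNormalQuantile (by linarith) hlt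
  have hchernoff := one_sub_exp_le_cdf_stdNormal (Real.sqrt_nonneg (2 * Real.log (1 / α)))
  have hlog : 0 ≤ Real.log (1 / α) := Real.log_nonneg (one_le_one_div hα0 hα1.le)
  have hexp : Real.exp (-√(2 * Real.log (1 / α)) ^ 2 / 2) = α := by
    rw [Real.sq_sqrt (by positivity), neg_div, mul_div_cancel_left₀ _ two_ne_zero, one_div,
      Real.log_inv, neg_neg, Real.exp_log hα0]
  linarith

theorem lt_gaussianReal_zero_real_Ioi {α a : ℝ} {v : NNReal} (hα : 0 < α)
    (ha : a < -stdNormalQuantile (1 - α) * √v) : 1 - α < (gaussianReal 0 v).real (Set.Ioi a) := by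
  rcases eq_or_ne v 0 with rfl | hv
  · have ha0 : a < 0 := by simpa using ha
    simp [gaussianReal_zero_var, measureReal_def, ha0, hα]
  · have hv0 : 0 < √(v : ℝ) := Real.sqrt_pos.2 (NNReal.coe_pos.2 (pos_iff_ne_zero.2 hv))
    have : NullSingletonClass (gaussianReal 0 v) := nullSingletonClass_gaussianReal hv
    rw [measureReal_congr Ioi_ae_eq_Ici, gaussianReal_zero_real_Ici hv]
    refine lt_cdf_of_stdNormalQuantile_lt (by linarith) ?_
    rw [lt_div_iff₀ hv0]
    linarith

theorem gaussianReal_zero_real_Ici_lt {α b : ℝ} {v : NNReal} (hα : α < 1)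
    (hb : -stdNormalQuantile (1 - α) * √v < b) : (gaussianReal 0 v).real (Set.Ici b) < 1 - α := by
  rcases eq_or_ne v 0 with rfl | hv
  · have hb0 : 0 < b := by simpa using hb
    simp [gaussianReal_zero_var, measureReal_def, hb0.not_ge, hα]
  · have hv0 : 0 < √(v : ℝ) := Real.sqrt_pos.2 (NNReal.coe_pos.2 (pos_iff_ne_zero.2 hv))
    rw [gaussianReal_zero_real_Ici hv]
    refine cdf_lt_of_lt_stdNormalQuantile (by linarith) ?_
    rw [div_lt_iff₀ hv0]
    linarith

theorem map_inner_multivariateGaussian {ι : Type*} [Fintype ι] [DecidableEq ι]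
    {C : Matrix ι ι ℝ} (hC : C.PosSemidef) (c : EuclideanSpace ℝ ι) :
    (multivariateGaussian 0 C).map (inner ℝ c) =
      gaussianReal 0 (c.ofLp ⬝ᵥ C *ᵥ c.ofLp).toNNReal := by
  have hmean : (multivariateGaussian 0 C)[innerSL ℝ c] = 0 := by
    rw [ContinuousLinearMap.integral_comp_id_comm IsGaussian.integrable_id]
    simp
  have hvar : Var[innerSL ℝ c; multivariateGaussian 0 C] = c.ofLp ⬝ᵥ C *ᵥ c.ofLp := by
    rw [← covarianceBilin_multivariateGaussian (μ := 0) hC,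
      covarianceBilin_self IsGaussian.memLp_two_id]
    rfl
  have hmap := IsGaussian.map_eq_gaussianReal (μ := multivariateGaussian 0 C) (innerSL ℝ c)
  rwa [hmean, hvar] at hmap

end NormalQuantile

/-! ### Fixed points and penalized maxima -/

theorem isFixedPt_iff_eq_fixedPoint {X : Type*} [MetricSpace X] [CompleteSpace X] [Nonempty X]
    {K : NNReal} {f : X → X} (hf : ContractingWith K f) {x : X} :
    f x = x ↔ x = hf.fixedPoint :=
  ⟨fun hx => hf.fixedPoint_unique hx, fun hx => hx ▸ hf.fixedPoint_isFixedPt⟩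

theorem tendsto_fixedPoint {ι X : Type*} [MetricSpace X] {l : Filter ι} {K : NNReal}
    {f : ι → X → X} (hf : ∀ i, ContractingWith K (f i)) {u : ι → X} (hu : ∀ i, f i (u i) = u i)
    {x : X} (hx : Tendsto (fun i => f i x) l (𝓝 x)) : Tendsto u l (𝓝 x) := by
  rw [tendsto_iff_dist_tendsto_zero] at hx ⊢
  refine squeeze_zero (fun _ => dist_nonneg) (fun i => ?_) (by simpa using hx.div_const (1 - K))
  rw [dist_comm (u i), dist_comm (f i x)]
  exact (hf i).dist_le_of_fixedPoint x (hu i)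

theorem tendsto_iSup_mul_add {ι K : Type*} [TopologicalSpace K] [CompactSpace K] {l : Filter ι}
    {k : ι → ℝ} (hk : Tendsto k l atTop) {d : K → ℝ} (hd : Continuous d) (hd0 : ∀ x, d x ≤ 0)
    (hdz : ∃ x, d x = 0) {h : ι → K → ℝ} {h' : K → ℝ}
    (hh : ∀ x, Tendsto (fun p : ι × K => h p.1 p.2) (l ×ˢ 𝓝 x) (𝓝 (h' x)))
    (hbdd : ∀ i, BddAbove (Set.range fun x => k i * d x + h i x))
    (hbdd' : BddAbove (h' '' {x | d x = 0})) :
    Tendsto (fun i => ⨆ x, (k i * d x + h i x)) l (𝓝 (sSup (h' '' {x | d x = 0}))) := by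
  have : Nonempty K := hdz.nonempty
  refine tendsto_order.2 ⟨fun a ha => ?_, fun b hb => ?_⟩
  · obtain ⟨_, ⟨x, hx, rfl⟩, hax⟩ := exists_lt_of_lt_csSup (Set.Nonempty.image h' hdz) ha
    have hpt : Tendsto (fun i => h i x) l (𝓝 (h' x)) :=
      (hh x).comp (tendsto_id.prodMk tendsto_const_nhds)
    filter_upwards [hpt.eventually_const_lt hax] with i hi
    refine hi.trans_le ((le_of_eq ?_).trans (le_ciSup (hbdd i) x))
    rw [show d x = 0 from hx, mul_zero, zero_add]
  · obtain ⟨c, hc, hcb⟩ := exists_between hb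
    have hlocal (x : K) : ∀ᶠ p : ι × K in l ×ˢ 𝓝 x, k p.1 * d p.2 + h p.1 p.2 < c := by
      have hkfst : Tendsto (fun p : ι × K => k p.1) (l ×ˢ 𝓝 x) atTop := hk.comp tendsto_fst
      rcases (hd0 x).eq_or_lt with hx | hx
      · have hxc : h' x < c := (le_csSup hbdd' ⟨x, hx, rfl⟩).trans_lt hc
        filter_upwards [(hh x).eventually_lt_const hxc, hkfst.eventually_ge_atTop 0] with p hp hkp
        linarith [mul_nonpos_of_nonneg_of_nonpos hkp (hd0 p.2)]
      · have hdx : Tendsto (fun p : ι × K => d p.2) (l ×ˢ 𝓝 x) (𝓝 (d x)) :=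
          (hd.tendsto x).comp tendsto_snd
        exact ((hkfst.atTop_mul_neg hx hdx).atBot_add (hh x)).eventually (eventually_lt_atBot c)
    have hunif : ∀ᶠ i in l, ∀ x ∈ Set.univ, k i * d x + h i x < c := by
      have hprod := isCompact_univ.mem_prod_nhdsSet_of_forall fun x _ => hlocal x
      rw [nhdsSet_univ, ← principal_univ] at hprod
      exact eventually_prod_principal_iff.1 hprod
    filter_upwards [hunif] with i hi
    exact (ciSup_le fun x => (hi x trivial).le).trans_lt hcb

theorem tendsto_iSup_mul_add_of_finite {ι K : Type*} [Finite K] {l : Filter ι} {k : ι → ℝ}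
    (hk : Tendsto k l atTop) {d : K → ℝ} (hd0 : ∀ x, d x ≤ 0) (hdz : ∃ x, d x = 0)
    {h : ι → K → ℝ} {h' : K → ℝ} (hh : ∀ x, Tendsto (fun i => h i x) l (𝓝 (h' x))) :
    Tendsto (fun i => ⨆ x, (k i * d x + h i x)) l (𝓝 (sSup (h' '' {x | d x = 0}))) := by
  let _ : TopologicalSpace K := ⊥
  have : DiscreteTopology K := ⟨rfl⟩
  refine tendsto_iSup_mul_add hk continuous_of_discreteTopology hd0 hdz (fun x => ?_)
    (fun _ => (Set.finite_range _).bddAbove) (Set.toFinite _).bddAbove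
  rw [nhds_discrete, prod_pure, tendsto_map'_iff]
  exact hh x

theorem mul_iSup_sub {ι : Type*} [Nonempty ι] {f : ι → ℝ} (hf : BddAbove (Set.range f)) {k : ℝ}
    (hk : 0 ≤ k) (b : ℝ) : k * ((⨆ i, f i) - b) = ⨆ i, k * (f i - b) := by
  rw [← Real.mul_iSup_of_nonneg hk, ciSup_sub hf]

theorem dist_iSup_le {ι : Type*} [Finite ι] [Nonempty ι] {f g : ι → ℝ} {c : ℝ}
    (h : ∀ i, dist (f i) (g i) ≤ c) : dist (⨆ i, f i) (⨆ i, g i) ≤ c := by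
  simp only [Real.dist_eq, abs_sub_le_iff, sub_le_iff_le_add'] at h ⊢
  exact ⟨ciSup_le fun i => (h i).1.trans
      (add_le_add_left (le_ciSup (Set.finite_range g).bddAbove i) c),
    ciSup_le fun i => (h i).2.trans
      (add_le_add_left (le_ciSup (Set.finite_range f).bddAbove i) c)⟩

/-! ### Convergence in distribution -/

/-- Convergence in probability to `0` of random variables whose probability spaces may vary with the
index, in which it differs from `MeasureTheory.TendstoInMeasure`. -/
def VanishesInProbability {ι E : Type*} [Norm E] {Ω : ι → Type*} [∀ i, MeasurableSpace (Ω i)]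
    (μ : (i : ι) → Measure (Ω i)) (l : Filter ι) (X : (i : ι) → Ω i → E) : Prop :=
  ∀ ε > 0, Tendsto (fun i => (μ i).real {ω | ε ≤ ‖X i ω‖}) l (𝓝 0)

section ConvergenceInDistribution

variable {ι E Ω' : Type*} {Ω : ι → Type*} {m : ∀ i, MeasurableSpace (Ω i)}
  {μ : (i : ι) → Measure (Ω i)} [∀ i, IsProbabilityMeasure (μ i)]
  {m' : MeasurableSpace Ω'} {μ' : Measure Ω'} [IsProbabilityMeasure μ'] {mE : MeasurableSpace E}
  {l : Filter ι}

theorem eventually_measureReal_preimage_lt [TopologicalSpace E] [OpensMeasurableSpace E]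
    [HasOuterApproxClosed E] {X : (i : ι) → Ω i → E} {Z : Ω' → E}
    (h : TendstoInDistribution X l Z μ μ') {F : Set E} (hF : IsClosed F) {r : ℝ}
    (hr : μ'.real (Z ⁻¹' F) < r) : ∀ᶠ i in l, (μ i).real (X i ⁻¹' F) < r := by
  have hlimsup := ProbabilityMeasure.limsup_measure_closed_le_of_tendsto h.tendsto hF
  have hlim : μ'.map Z F < ENNReal.ofReal r := by
    rw [Measure.map_apply_of_aemeasurable h.aemeasurable_limit hF.measurableSet]
    exact (ENNReal.lt_ofReal_iff_toReal_lt (measure_ne_top _ _)).2 hr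
  filter_upwards [eventually_lt_of_limsup_lt (hlimsup.trans_lt hlim)] with i hi
  rw [ProbabilityMeasure.coe_mk,
    Measure.map_apply_of_aemeasurable (h.forall_aemeasurable i) hF.measurableSet] at hi
  exact (ENNReal.lt_ofReal_iff_toReal_lt (measure_ne_top _ _)).1 hi

theorem eventually_lt_measureReal_preimage [TopologicalSpace E] [OpensMeasurableSpace E]
    [HasOuterApproxClosed E] {X : (i : ι) → Ω i → E} {Z : Ω' → E}
    (h : TendstoInDistribution X l Z μ μ') {G : Set E} (hG : IsOpen G) {r : ℝ}
    (hr : r < μ'.real (Z ⁻¹' G)) : ∀ᶠ i in l, r < (μ i).real (X i ⁻¹' G) := by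
  rcases lt_or_ge r 0 with hr0 | hr0
  · exact .of_forall fun i => hr0.trans_le measureReal_nonneg
  have hliminf := ProbabilityMeasure.le_liminf_measure_open_of_tendsto h.tendsto hG
  have hlim : ENNReal.ofReal r < μ'.map Z G := by
    rw [Measure.map_apply_of_aemeasurable h.aemeasurable_limit hG.measurableSet]
    exact (ENNReal.ofReal_lt_iff_lt_toReal hr0 (measure_ne_top _ _)).2 hr
  filter_upwards [eventually_lt_of_lt_liminf (hlim.trans_le hliminf)] with i hi
  rw [ProbabilityMeasure.coe_mk,
    Measure.map_apply_of_aemeasurable (h.forall_aemeasurable i) hG.measurableSet] at hi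
  exact (ENNReal.ofReal_lt_iff_lt_toReal hr0 (measure_ne_top _ _)).1 hi

theorem tendstoInDistribution_comp_tendsto [TopologicalSpace E] [OpensMeasurableSpace E]
    {X : (i : ι) → Ω i → E} {Z : Ω' → E} (h : TendstoInDistribution X l Z μ μ') {κ : Type*}
    {l' : Filter κ} {N : κ → ι} (hN : Tendsto N l' l) :
    TendstoInDistribution (fun j => X (N j)) l' Z (fun j => μ (N j)) μ' where
  forall_aemeasurable j := h.forall_aemeasurable (N j)
  aemeasurable_limit := h.aemeasurable_limit
  tendsto := h.tendsto.comp hN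

section Slutsky

variable [NormedAddCommGroup E] [BorelSpace E] {X : (i : ι) → Ω i → E} {Z : Ω' → E}

theorem exists_eventually_measureReal_le_norm_lt (h : TendstoInDistribution X l Z μ μ') {η : ℝ}
    (hη : 0 < η) : ∃ M > 0, ∀ᶠ i in l, (μ i).real {ω | M ≤ ‖X i ω‖} < η := by
  have hempty : ⋂ M : ℝ, {ω | M ≤ ‖Z ω‖} = ∅ :=
    Set.eq_empty_of_forall_notMem fun ω hω => (lt_add_one ‖Z ω‖).not_ge (Set.mem_iInter.1 hω _)
  have htail : Tendsto (fun M : ℝ => μ'.real {ω | M ≤ ‖Z ω‖}) atTop (𝓝 0) := by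
    have hlim := tendsto_measure_iInter_atTop (μ := μ') (s := fun M : ℝ => {ω | M ≤ ‖Z ω‖})
      (fun M => nullMeasurableSet_le aemeasurable_const h.aemeasurable_limit.norm)
      (fun _ _ hMM' _ hω => hMM'.trans hω) ⟨0, measure_ne_top _ _⟩
    rw [hempty, measure_empty] at hlim
    exact (ENNReal.tendsto_toReal ENNReal.zero_ne_top).comp hlim
  obtain ⟨M, hMη, hM⟩ := ((htail.eventually_lt_const hη).and (eventually_gt_atTop 0)).exists
  exact ⟨M, hM, eventually_measureReal_preimage_lt h
    (isClosed_le continuous_const continuous_norm : IsClosed {z : E | M ≤ ‖z‖}) hMη⟩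

theorem vanishesInProbability_inner [InnerProductSpace ℝ E] {c : (i : ι) → Ω i → E}
    (hc : VanishesInProbability μ l c) (h : TendstoInDistribution X l Z μ μ') :
    VanishesInProbability μ l fun i ω => inner ℝ (c i ω) (X i ω) := by
  intro ε hε
  refine tendsto_order.2 ⟨fun a ha => .of_forall fun i => ha.trans_le measureReal_nonneg,
    fun η hη => ?_⟩
  obtain ⟨M, hM, hMη⟩ := exists_eventually_measureReal_le_norm_lt h (half_pos hη)
  filter_upwards [hMη, (hc (ε / M) (by positivity)).eventually_lt_const (half_pos hη)] with i hX hci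
  have hsub : {ω | ε ≤ ‖inner ℝ (c i ω) (X i ω)‖} ⊆
      {ω | M ≤ ‖X i ω‖} ∪ {ω | ε / M ≤ ‖c i ω‖} := by
    intro ω hω
    by_contra! hcon
    simp only [Set.mem_union, Set.mem_ofPred_eq, not_or, not_le] at hω hcon
    have hlt : ‖c i ω‖ * ‖X i ω‖ < ε / M * M :=
      mul_lt_mul'' hcon.2 hcon.1 (norm_nonneg _) (norm_nonneg _)
    rw [div_mul_cancel₀ _ hM.ne'] at hlt
    exact (hω.trans (norm_inner_le_norm _ _)).not_gt hlt
  linarith [(measureReal_mono hsub).trans (measureReal_union_le (μ := μ i) _ _)]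

end Slutsky

variable {X Y : (i : ι) → Ω i → ℝ} {Z : Ω' → ℝ}

theorem eventually_lt_measureReal_le_of_sub_vanishes (hY : TendstoInDistribution Y l Z μ μ')
    (hXY : VanishesInProbability μ l fun i ω => X i ω - Y i ω) {a b r : ℝ} (hab : a < b)
    (hr : r < μ'.real {ω | b < Z ω}) : ∀ᶠ i in l, r < (μ i).real {ω | a ≤ X i ω} := by
  obtain ⟨r', hrr', hr'⟩ := exists_between hr
  filter_upwards [eventually_lt_measureReal_preimage hY isOpen_Ioi hr',
    (hXY (b - a) (sub_pos.2 hab)).eventually_lt_const (sub_pos.2 hrr')] with i hYi hXYi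
  have hsub : Y i ⁻¹' Set.Ioi b ⊆ {ω | a ≤ X i ω} ∪ {ω | b - a ≤ ‖X i ω - Y i ω‖} := by
    intro ω (hω : b < Y i ω)
    refine or_iff_not_imp_left.2 fun (hX : ¬a ≤ X i ω) => ?_
    have hdist : b - a ≤ -(X i ω - Y i ω) := by linarith
    exact hdist.trans (neg_le_abs _)
  linarith [(measureReal_mono hsub).trans (measureReal_union_le (μ := μ i) _ _)]

theorem eventually_measureReal_le_lt_of_sub_vanishes (hY : TendstoInDistribution Y l Z μ μ')
    (hXY : VanishesInProbability μ l fun i ω => X i ω - Y i ω) {a b r : ℝ} (hab : a < b)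
    (hr : μ'.real {ω | a ≤ Z ω} < r) : ∀ᶠ i in l, (μ i).real {ω | b ≤ X i ω} < r := by
  obtain ⟨r', hr', hrr'⟩ := exists_between hr
  filter_upwards [eventually_measureReal_preimage_lt hY isClosed_Ici hr',
    (hXY (b - a) (sub_pos.2 hab)).eventually_lt_const (sub_pos.2 hrr')] with i hYi hXYi
  have hsub : {ω | b ≤ X i ω} ⊆ Y i ⁻¹' Set.Ici a ∪ {ω | b - a ≤ ‖X i ω - Y i ω‖} := by
    intro ω (hω : b ≤ X i ω)
    refine or_iff_not_imp_left.2 fun (hYa : ¬a ≤ Y i ω) => ?_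
    have hdist : b - a ≤ X i ω - Y i ω := by linarith
    exact hdist.trans (le_abs_self _)
  linarith [(measureReal_mono hsub).trans (measureReal_union_le (μ := μ i) _ _)]

theorem tendsto_mul_valueAtRisk_sub {k b : ι → ℝ} (hk : ∀ᶠ i in l, 0 < k i)
    (hY : TendstoInDistribution Y l Z μ μ')
    (hXY : VanishesInProbability μ l fun i ω => k i * (X i ω - b i) - Y i ω) {α q : ℝ}
    (hlow : ∀ a < q, 1 - α < μ'.real {ω | a < Z ω})
    (hupp : ∀ a > q, μ'.real {ω | a ≤ Z ω} < 1 - α) :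
    Tendsto (fun i => k i * (valueAtRisk (μ i) α (X i) - b i)) l (𝓝 q) := by
  have hx (x : ℝ) (hxq : x < q) : ∀ᶠ i in l, 1 - α < (μ i).real {ω | x ≤ k i * (X i ω - b i)} := by
    obtain ⟨a, hxa, haq⟩ := exists_between hxq
    exact eventually_lt_measureReal_le_of_sub_vanishes hY hXY hxa (hlow a haq)
  have hy (y : ℝ) (hqy : q < y) : ∀ᶠ i in l, (μ i).real {ω | y ≤ k i * (X i ω - b i)} < 1 - α := by
    obtain ⟨a, hqa, hay⟩ := exists_between hqy
    exact eventually_measureReal_le_lt_of_sub_vanishes hY hXY hay (hupp a hqa)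
  refine tendsto_order.2 ⟨fun a haq => ?_, fun a hqa => ?_⟩
  · obtain ⟨x, hax, hxq⟩ := exists_between haq
    filter_upwards [hk, hx x hxq, hy (q + 1) (lt_add_one q)] with i hki hxi hyi
    exact hax.trans_le (mul_valueAtRisk_sub_mem_Icc hki hxi.le hyi).1
  · obtain ⟨y, hqy, hya⟩ := exists_between hqa
    filter_upwards [hk, hx (q - 1) (sub_one_lt q), hy y hqy] with i hki hxi hyi
    exact (mul_valueAtRisk_sub_mem_Icc hki hxi.le hyi).2.trans_lt hya

end ConvergenceInDistribution

/-! ### Asymptotically normal posteriors -/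

/-- The posterior `post N` after `N` observations is asymptotically normal at `Pstar`: under it,
`√N (P - Pstar)` converges in distribution to a centred normal vector with covariance `C`. -/
def AsymptoticallyNormal {S A : ℕ} (Pstar : Transition S A) (post : ℕ → Measure (Transition S A))
    [∀ N, IsProbabilityMeasure (post N)]
    (C : Matrix (Fin S × Fin A × Fin S) (Fin S × Fin A × Fin S) ℝ) : Prop :=
  TendstoInDistribution (fun N => scaledDeviation Pstar N) atTop
    (id : EuclideanSpace ℝ (Fin S × Fin A × Fin S) → _) post (multivariateGaussian 0 C)

theorem tendsto_sqrt_natCast_atTop : Tendsto (fun N : ℕ => √(N : ℝ)) atTop atTop :=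
  Real.tendsto_sqrt_atTop.comp tendsto_natCast_atTop_atTop

section AsymptoticNormality

variable {S A : ℕ} {Pstar : Transition S A} {ι : Type*} {l : Filter ι} {N : ι → ℕ}

theorem sqrt_mul_dist_le_norm_scaledDeviation (N : ℕ) (P : Transition S A) :
    √(N : ℝ) * dist P Pstar ≤ ‖scaledDeviation Pstar N P‖ := by
  have hentry (s : Fin S) (a : Fin A) (s' : Fin S) :
      √(N : ℝ) * dist (P s a s') (Pstar s a s') ≤ ‖scaledDeviation Pstar N P‖ := by
    have h := PiLp.norm_apply_le (scaledDeviation Pstar N P) (s, a, s')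
    simpa [scaledDeviation, Real.dist_eq, abs_mul, abs_of_nonneg (Real.sqrt_nonneg (N : ℝ))] using h
  rcases (Real.sqrt_nonneg (N : ℝ)).eq_or_lt with hN | hN
  · rw [← hN, zero_mul]
    exact norm_nonneg _
  · simp only [← le_div_iff₀' hN] at hentry ⊢
    have hnonneg : 0 ≤ ‖scaledDeviation Pstar N P‖ / √(N : ℝ) := by positivity
    exact (dist_pi_le_iff hnonneg).2 fun s => (dist_pi_le_iff hnonneg).2 fun a =>
      (dist_pi_le_iff hnonneg).2 (hentry s a)

theorem eventually_forall_norm_scaledDeviation_lt (hN : Tendsto N l atTop) (M : ℝ)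
    {p : ι × Transition S A → Prop} (hp : ∀ᶠ x in l ×ˢ 𝓝 Pstar, p x) :
    ∀ᶠ i in l, ∀ P, ‖scaledDeviation Pstar (N i) P‖ < M → p (i, P) := by
  obtain ⟨pa, ha, pb, hb, hab⟩ := eventually_prod_iff.1 hp
  obtain ⟨ε, hε, hball⟩ := Metric.eventually_nhds_iff.1 hb
  have hsqrt : Tendsto (fun i => √(N i : ℝ)) l atTop :=
    tendsto_sqrt_natCast_atTop.comp hN
  filter_upwards [ha, hsqrt.eventually_gt_atTop (M / ε), hsqrt.eventually_gt_atTop 0]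
    with i hi hMε hpos P hP
  rw [div_lt_iff₀ hε] at hMε
  exact hab hi (hball (lt_of_mul_lt_mul_left
    (((sqrt_mul_dist_le_norm_scaledDeviation (N i) P).trans_lt hP).trans hMε) hpos.le))

variable {post : ℕ → Measure (Transition S A)} [∀ N, IsProbabilityMeasure (post N)]
  {C : Matrix (Fin S × Fin A × Fin S) (Fin S × Fin A × Fin S) ℝ}

theorem vanishesInProbability_sub_const {E : Type*} [NormedAddCommGroup E]
    (hnormal : AsymptoticallyNormal Pstar post C) (hN : Tendsto N l atTop)
    {c : ι → Transition S A → E} {c₀ : E}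
    (hc : Tendsto (fun x : ι × Transition S A => c x.1 x.2) (l ×ˢ 𝓝 Pstar) (𝓝 c₀)) :
    VanishesInProbability (fun i => post (N i)) l fun i P => c i P - c₀ := by
  intro ε hε
  refine tendsto_order.2 ⟨fun a ha => .of_forall fun i => ha.trans_le measureReal_nonneg,
    fun η hη => ?_⟩
  obtain ⟨M, -, hMη⟩ := exists_eventually_measureReal_le_norm_lt hnormal hη
  filter_upwards [hN.eventually hMη, eventually_forall_norm_scaledDeviation_lt hN M
    ((Metric.tendsto_nhds.1 hc) ε hε)] with i hMi hci
  refine (measureReal_mono fun P (hP : ε ≤ ‖c i P - c₀‖) => ?_).trans_lt hMi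
  by_contra! hPM
  exact hP.not_gt (dist_eq_norm (c i P) c₀ ▸ hci P (not_le.1 hPM))

theorem tendsto_sqrt_mul_valueAtRisk_sub (hC : C.PosSemidef)
    (hnormal : AsymptoticallyNormal Pstar post C) (hN : Tendsto N l atTop) {α : ℝ} (hα0 : 0 < α)
    (hα1 : α < 1) {X : ι → Transition S A → ℝ} {b : ι → ℝ}
    {c : ι → Transition S A → EuclideanSpace ℝ (Fin S × Fin A × Fin S)}
    {c₀ : EuclideanSpace ℝ (Fin S × Fin A × Fin S)}
    (hc : Tendsto (fun x : ι × Transition S A => c x.1 x.2) (l ×ˢ 𝓝 Pstar) (𝓝 c₀))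
    (hX : ∀ i P, √(N i : ℝ) * (X i P - b i) =
      inner ℝ (c i P) (scaledDeviation Pstar (N i) P)) :
    Tendsto (fun i => √(N i : ℝ) * (valueAtRisk (post (N i)) α (X i) - b i)) l
      (𝓝 (-stdNormalQuantile (1 - α) * √(c₀.ofLp ⬝ᵥ C *ᵥ c₀.ofLp))) := by
  have hcont : Continuous (inner ℝ c₀ : EuclideanSpace ℝ (Fin S × Fin A × Fin S) → ℝ) := by
    fun_prop
  have hdev := tendstoInDistribution_comp_tendsto hnormal hN
  have hlaw (s : Set ℝ) (hs : MeasurableSet s) : (multivariateGaussian 0 C).real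
      (inner ℝ c₀ ⁻¹' s) = (gaussianReal 0 (c₀.ofLp ⬝ᵥ C *ᵥ c₀.ofLp).toNNReal).real s := by
    rw [← map_inner_multivariateGaussian hC, map_measureReal_apply hcont.measurable hs]
  have hvar : √((c₀.ofLp ⬝ᵥ C *ᵥ c₀.ofLp).toNNReal : ℝ) = √(c₀.ofLp ⬝ᵥ C *ᵥ c₀.ofLp) := by
    rw [Real.coe_toNNReal _ (by simpa using hC.dotProduct_mulVec_nonneg c₀.ofLp)]
  have hsqrt : Tendsto (fun i => √(N i : ℝ)) l atTop :=
    tendsto_sqrt_natCast_atTop.comp hN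
  refine tendsto_mul_valueAtRisk_sub (hsqrt.eventually_gt_atTop 0)
    (hdev.continuous_comp hcont) ?_ (fun a ha => ?_) fun a ha => ?_
  · have hslutsky :=
      vanishesInProbability_inner (vanishesInProbability_sub_const hnormal hN hc) hdev
    simpa only [hX, inner_sub_left, Function.comp_apply] using hslutsky
  · rw [← hvar] at ha
    exact (lt_gaussianReal_zero_real_Ioi hα0 ha).trans_eq (hlaw _ measurableSet_Ioi).symm
  · rw [← hvar] at ha
    exact (hlaw _ measurableSet_Ici).trans_lt (gaussianReal_zero_real_Ici_lt hα1 ha)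

end AsymptoticNormality

/-! ### Policy evaluation -/

section Simplex

variable {ι : Type*} [Fintype ι] (p : stdSimplex ℝ ι)

theorem simplex_dotProduct_const (c : ℝ) : ((p : ι → ℝ) ⬝ᵥ fun _ => c) = c := by
  rw [dotProduct, ← Finset.sum_mul, stdSimplex.sum_eq_one, one_mul]

theorem simplex_dotProduct_mono {x y : ι → ℝ} (h : ∀ i, x i ≤ y i) :
    (p : ι → ℝ) ⬝ᵥ x ≤ (p : ι → ℝ) ⬝ᵥ y :=
  dotProduct_le_dotProduct_of_nonneg_left h (stdSimplex.zero_le p)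

theorem simplex_dotProduct_le {x : ι → ℝ} {c : ℝ} (h : ∀ i, x i ≤ c) : (p : ι → ℝ) ⬝ᵥ x ≤ c :=
  (simplex_dotProduct_mono p h).trans_eq (simplex_dotProduct_const p c)

theorem le_simplex_dotProduct {x : ι → ℝ} {c : ℝ} (h : ∀ i, c ≤ x i) : c ≤ (p : ι → ℝ) ⬝ᵥ x :=
  (simplex_dotProduct_const p c).symm.trans_le (simplex_dotProduct_mono p h)

theorem abs_simplex_dotProduct_le (x : ι → ℝ) : |(p : ι → ℝ) ⬝ᵥ x| ≤ ‖x‖ :=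
  abs_le.2 ⟨le_simplex_dotProduct p fun i => (abs_le.1 (norm_le_pi_norm x i)).1,
    simplex_dotProduct_le p fun i => (abs_le.1 (norm_le_pi_norm x i)).2⟩

theorem dist_simplex_dotProduct_le (x y : ι → ℝ) :
    dist ((p : ι → ℝ) ⬝ᵥ x) ((p : ι → ℝ) ⬝ᵥ y) ≤ dist x y := by
  rw [Real.dist_eq, ← dotProduct_sub, dist_eq_norm]
  exact abs_simplex_dotProduct_le p (x - y)

theorem integral_simplexMeasure {n : ℕ} (p : stdSimplex ℝ (Fin n)) (f : Fin n → ℝ) :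
    ∫ i, f i ∂(simplexMeasure p) = (p : Fin n → ℝ) ⬝ᵥ f := by
  rw [simplexMeasure, integral_finsetSum_measure]
  · simp [dotProduct]
  · intro i _
    exact Integrable.smul_measure (by simp) ENNReal.ofReal_ne_top

end Simplex

theorem isUnit_det_one_sub_smul {ι : Type*} [Fintype ι] [DecidableEq ι] {M : Matrix ι ι ℝ}
    (hM : ∀ x, ‖M *ᵥ x‖ ≤ ‖x‖) {γ : ℝ} (hγ0 : 0 ≤ γ) (hγ1 : γ < 1) :
    IsUnit (1 - γ • M).det := by
  rw [isUnit_iff_ne_zero]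
  intro hdet
  obtain ⟨x, hx, hx0⟩ := Matrix.exists_mulVec_eq_zero_iff.2 hdet
  rw [Matrix.sub_mulVec, Matrix.one_mulVec, Matrix.smul_mulVec, sub_eq_zero] at hx0
  have hnorm : ‖x‖ = γ * ‖M *ᵥ x‖ := by
    conv_lhs => rw [hx0]
    rw [norm_smul, Real.norm_of_nonneg hγ0]
  nlinarith [mul_le_mul_of_nonneg_left (hM x) hγ0, norm_pos_iff.2 hx]

noncomputable section

variable {S A : ℕ}

/-- The transition matrix of the state process under the policy `π`. -/
def policyMatrix (π : Policy S A) (P : Transition S A) : Matrix (Fin S) (Fin S) ℝ :=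
  Matrix.of fun s s' => ∑ a, π s a * P s a s'

/-- The expected one-step reward under the policy `π`. -/
def policyReward (R : Fin S → Fin A → Fin S → ℝ) (π : Policy S A) (P : Transition S A) :
    Fin S → ℝ :=
  fun s => (π s : Fin A → ℝ) ⬝ᵥ fun a => (P s a : Fin S → ℝ) ⬝ᵥ R s a

/-- The value function of the policy `π`. -/
def policyValue (R : Fin S → Fin A → Fin S → ℝ) (γ : ℝ) (π : Policy S A) (P : Transition S A) :
    Fin S → ℝ :=
  (1 - γ • policyMatrix π P)⁻¹ *ᵥ policyReward R π P

/-- The value `p_{s,a}ᵀ (r_{s,a} + γ v)` of the action `a` in state `s` if the values of the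
successor states are `v`. -/
def actionValue (R : Fin S → Fin A → Fin S → ℝ) (γ : ℝ) (P : Transition S A) (v : Fin S → ℝ)
    (s : Fin S) (a : Fin A) : ℝ :=
  (P s a : Fin S → ℝ) ⬝ᵥ oneStepValue R γ v s a

theorem actionValue_eq_add (R : Fin S → Fin A → Fin S → ℝ) (γ : ℝ) (P : Transition S A)
    (v : Fin S → ℝ) (s : Fin S) (a : Fin A) :
    actionValue R γ P v s a =
      (P s a : Fin S → ℝ) ⬝ᵥ R s a + γ * ((P s a : Fin S → ℝ) ⬝ᵥ v) := by
  rw [actionValue, oneStepValue, dotProduct_add, dotProduct_smul, smul_eq_mul]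

theorem policyMatrix_mulVec (π : Policy S A) (P : Transition S A) (x : Fin S → ℝ) (s : Fin S) :
    (policyMatrix π P *ᵥ x) s = (π s : Fin A → ℝ) ⬝ᵥ fun a => (P s a : Fin S → ℝ) ⬝ᵥ x := by
  simp only [policyMatrix, Matrix.mulVec, dotProduct, Matrix.of_apply, Finset.sum_mul,
    Finset.mul_sum, mul_assoc]
  exact Finset.sum_comm

theorem norm_policyMatrix_mulVec_le (π : Policy S A) (P : Transition S A) (x : Fin S → ℝ) :
    ‖policyMatrix π P *ᵥ x‖ ≤ ‖x‖ := by
  refine (pi_norm_le_iff_of_nonneg (norm_nonneg _)).2 fun s => ?_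
  rw [policyMatrix_mulVec]
  exact (abs_simplex_dotProduct_le _ _).trans
    ((pi_norm_le_iff_of_nonneg (norm_nonneg _)).2 fun a => abs_simplex_dotProduct_le _ _)

theorem isUnit_det_one_sub_smul_policyMatrix {γ : ℝ} (hγ0 : 0 ≤ γ) (hγ1 : γ < 1)
    (π : Policy S A) (P : Transition S A) : IsUnit (1 - γ • policyMatrix π P).det :=
  isUnit_det_one_sub_smul (norm_policyMatrix_mulVec_le π P) hγ0 hγ1

theorem policyReward_add_smul_mulVec (R : Fin S → Fin A → Fin S → ℝ) (γ : ℝ) (π : Policy S A)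
    (P : Transition S A) (v : Fin S → ℝ) :
    policyReward R π P + γ • (policyMatrix π P *ᵥ v) =
      fun s => (π s : Fin A → ℝ) ⬝ᵥ actionValue R γ P v s := by
  ext s
  have hadd : actionValue R γ P v s =
      (fun a => (P s a : Fin S → ℝ) ⬝ᵥ R s a) + γ • fun a => (P s a : Fin S → ℝ) ⬝ᵥ v :=
    funext fun a => actionValue_eq_add R γ P v s a
  rw [hadd, dotProduct_add, dotProduct_smul, ← policyMatrix_mulVec]
  rfl

theorem policyValue_bellman (R : Fin S → Fin A → Fin S → ℝ) {γ : ℝ} (hγ0 : 0 ≤ γ) (hγ1 : γ < 1)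
    (π : Policy S A) (P : Transition S A) (s : Fin S) :
    policyValue R γ π P s = (π s : Fin A → ℝ) ⬝ᵥ actionValue R γ P (policyValue R γ π P) s := by
  have hsolve : (1 - γ • policyMatrix π P) *ᵥ policyValue R γ π P = policyReward R π P := by
    rw [policyValue, Matrix.mulVec_mulVec,
      Matrix.mul_nonsing_inv _ (isUnit_det_one_sub_smul_policyMatrix hγ0 hγ1 π P),
      Matrix.one_mulVec]
  rw [Matrix.sub_mulVec, Matrix.one_mulVec, Matrix.smul_mulVec, sub_eq_iff_eq_add] at hsolve
  exact congrFun (hsolve.trans (policyReward_add_smul_mulVec R γ π P _)) s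

end

/-! ### The expected return as a value function -/

section Trajectory

variable {S A : ℕ} (p₀ : stdSimplex ℝ (Fin S)) (π : Policy S A) (P : Transition S A)

instance : IsProbabilityMeasure (trajectoryLaw p₀ π P) :=
  inferInstanceAs (IsProbabilityMeasure (Kernel.trajMeasure (X := fun _ => Fin S × Fin A)
    (simplexMeasure p₀ ⊗ₘ policyKernel π) (historyKernel π P)))

theorem integral_simplexMeasure_compProd_policyKernel (f : Fin S × Fin A → ℝ) :
    ∫ x, f x ∂(simplexMeasure p₀ ⊗ₘ policyKernel π) =
      (p₀ : Fin S → ℝ) ⬝ᵥ fun s => (π s : Fin A → ℝ) ⬝ᵥ fun a => f (s, a) := by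
  rw [Measure.integral_compProd .of_finite, integral_simplexMeasure]
  congr 1
  ext s
  exact integral_simplexMeasure (π s) fun a => f (s, a)

theorem map_eval_zero_trajectoryLaw :
    (trajectoryLaw p₀ π P).map (fun ω => ω 0) = simplexMeasure p₀ ⊗ₘ policyKernel π := by
  have hhistory : (trajectoryLaw p₀ π P).map (Preorder.frestrictLe 0) =
      (simplexMeasure p₀ ⊗ₘ policyKernel π).map
        (MeasurableEquiv.piUnique (fun _ : Finset.Iic 0 => Fin S × Fin A)).symm := by
    rw [trajectoryLaw, Kernel.trajMeasure, Measure.map_comp _ _ (by fun_prop),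
      Kernel.traj_map_frestrictLe, Kernel.partialTraj_self, Measure.id_comp]
  have heval : (fun ω : ℕ → Fin S × Fin A => ω 0) =
      (fun h : Finset.Iic 0 → Fin S × Fin A => h ⟨0, Finset.mem_Iic.2 le_rfl⟩) ∘
        Preorder.frestrictLe (π := fun _ => Fin S × Fin A) 0 := rfl
  rw [heval, ← Measure.map_map (by fun_prop) (by fun_prop), hhistory,
    Measure.map_map (by fun_prop) (by fun_prop)]
  exact Measure.map_id

theorem integral_trajectoryLaw_eval_zero (f : Fin S × Fin A → ℝ) :
    ∫ ω, f (ω 0) ∂(trajectoryLaw p₀ π P) =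
      (p₀ : Fin S → ℝ) ⬝ᵥ fun s => (π s : Fin A → ℝ) ⬝ᵥ fun a => f (s, a) := by
  rw [← integral_simplexMeasure_compProd_policyKernel, ← map_eval_zero_trajectoryLaw p₀ π P,
    integral_map (measurable_pi_apply 0).aemeasurable
      (Measurable.of_discrete).aestronglyMeasurable]

theorem integrable_trajectoryLaw (f : (Fin S × Fin A) × (Fin S × Fin A) → ℝ) (t u : ℕ) :
    Integrable (fun ω => f (ω t, ω u)) (trajectoryLaw p₀ π P) := by
  have hmeas : Measurable fun ω : ℕ → Fin S × Fin A => (ω t, ω u) := by fun_prop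
  exact Integrable.comp_measurable (g := f) .of_finite hmeas

theorem integral_trajectoryLaw_step (f : (Fin S × Fin A) × (Fin S × Fin A) → ℝ) (t : ℕ) :
    ∫ ω, f (ω t, ω (t + 1)) ∂(trajectoryLaw p₀ π P) =
      ∫ ω, ((P (ω t).1 (ω t).2 : Fin S → ℝ) ⬝ᵥ fun s => (π s : Fin A → ℝ) ⬝ᵥ
        fun a => f (ω t, (s, a))) ∂(trajectoryLaw p₀ π P) := by
  let g : (Finset.Iic t → Fin S × Fin A) × (Fin S × Fin A) → ℝ :=
    fun x => f (x.1 ⟨t, Finset.mem_Iic.2 le_rfl⟩, x.2)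
  calc ∫ ω, f (ω t, ω (t + 1)) ∂(trajectoryLaw p₀ π P)
      = ∫ x, g x ∂((trajectoryLaw p₀ π P).map
          fun ω => (Preorder.frestrictLe (π := fun _ => Fin S × Fin A) t ω, ω (t + 1))) := by
        rw [integral_map (by fun_prop) (Measurable.of_discrete).aestronglyMeasurable]
        rfl
    _ = ∫ x, g x ∂((trajectoryLaw p₀ π P).map
          (Preorder.frestrictLe (π := fun _ => Fin S × Fin A) t) ⊗ₘ historyKernel π P t) := by
        rw [trajectoryLaw, Kernel.map_frestrictLe_trajMeasure_compProd_eq_map_trajMeasure]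
    _ = ∫ x, ∫ y, g (x, y) ∂(historyKernel π P t x) ∂((trajectoryLaw p₀ π P).map
          (Preorder.frestrictLe (π := fun _ => Fin S × Fin A) t)) := by
        have : IsProbabilityMeasure ((trajectoryLaw p₀ π P).map
          (Preorder.frestrictLe (π := fun _ => Fin S × Fin A) t)) :=
            Measure.isProbabilityMeasure_map (by fun_prop)
        exact Measure.integral_compProd .of_finite
    _ = ∫ ω, ∫ y, f (ω t, y) ∂(stepKernel π P (ω t)) ∂(trajectoryLaw p₀ π P) := by
        rw [integral_map (by fun_prop) (Measurable.of_discrete).aestronglyMeasurable]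
        rfl
    _ = _ := by
        congr 1
        ext ω
        exact integral_simplexMeasure_compProd_policyKernel _ π fun y => f (ω t, y)

theorem integral_trajectoryLaw_reward (R : Fin S → Fin A → Fin S → ℝ) {γ : ℝ} (hγ0 : 0 ≤ γ)
    (hγ1 : γ < 1) (t : ℕ) :
    ∫ ω, R (ω t).1 (ω t).2 (ω (t + 1)).1 ∂(trajectoryLaw p₀ π P) =
      ∫ ω, actionValue R γ P (policyValue R γ π P) (ω t).1 (ω t).2 ∂(trajectoryLaw p₀ π P) -
        γ * ∫ ω, actionValue R γ P (policyValue R γ π P) (ω (t + 1)).1 (ω (t + 1)).2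
          ∂(trajectoryLaw p₀ π P) := by
  set v := policyValue R γ π P
  rw [eq_sub_iff_add_eq, ← integral_const_mul, ← integral_add
    (integrable_trajectoryLaw p₀ π P (fun x => R x.1.1 x.1.2 x.2.1) t (t + 1))
    (integrable_trajectoryLaw p₀ π P (fun x => γ * actionValue R γ P v x.2.1 x.2.2) t (t + 1)),
    integral_trajectoryLaw_step p₀ π P
      (fun x => R x.1.1 x.1.2 x.2.1 + γ * actionValue R γ P v x.2.1 x.2.2)]
  congr 1
  ext ω
  refine congrArg _ (funext fun s' => ?_)
  have hadd : (fun a => R (ω t).1 (ω t).2 s' + γ * actionValue R γ P v s' a) =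
      (fun _ => R (ω t).1 (ω t).2 s') + γ • actionValue R γ P v s' := rfl
  rw [hadd, dotProduct_add, dotProduct_smul, simplex_dotProduct_const,
    ← policyValue_bellman R hγ0 hγ1]
  rfl

end Trajectory

theorem hasSum_pow_mul_integral {Ω : Type*} [MeasurableSpace Ω] {μ : Measure Ω}
    [IsFiniteMeasure μ] {γ : ℝ} (hγ0 : 0 ≤ γ) (hγ1 : γ < 1) {f : ℕ → Ω → ℝ}
    (hf : ∀ t, Integrable (f t) μ) {B : ℝ} (hB : ∀ t ω, ‖f t ω‖ ≤ B) :
    HasSum (fun t => γ ^ t * ∫ ω, f t ω ∂μ) (∫ ω, ∑' t, γ ^ t * f t ω ∂μ) := by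
  simp only [← integral_const_mul]
  refine hasSum_integral_of_summable_integral_norm (fun t => (hf t).const_mul (γ ^ t)) ?_
  refine .of_nonneg_of_le (fun t => integral_nonneg fun _ => norm_nonneg _) (fun t => ?_)
    ((summable_geometric_of_lt_one hγ0 hγ1).mul_right (B * μ.real Set.univ))
  calc ∫ ω, ‖γ ^ t * f t ω‖ ∂μ = γ ^ t * ∫ ω, ‖f t ω‖ ∂μ := by
        simp only [norm_mul, norm_pow, Real.norm_of_nonneg hγ0, integral_const_mul]
    _ ≤ γ ^ t * ∫ _, B ∂μ := by
        gcongr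
        exacts [(hf t).norm, integrable_const B, fun ω => hB t ω]
    _ = γ ^ t * (B * μ.real Set.univ) := by rw [integral_const, smul_eq_mul, mul_comm B]

theorem hasSum_pow_mul_sub_succ {γ : ℝ} (hγ0 : 0 ≤ γ) (hγ1 : γ < 1) {q : ℕ → ℝ} {B : ℝ}
    (hq : ∀ t, ‖q t‖ ≤ B) : HasSum (fun t => γ ^ t * (q t - γ * q (t + 1))) (q 0) := by
  have hsummable : Summable fun t => γ ^ t * q t := by
    refine .of_norm_bounded ((summable_geometric_of_lt_one hγ0 hγ1).mul_right B) fun t => ?_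
    rw [norm_mul, norm_pow, Real.norm_of_nonneg hγ0]
    exact mul_le_mul_of_nonneg_left (hq t) (pow_nonneg hγ0 t)
  have htail := (hasSum_nat_add_iff' 1).2 hsummable.hasSum
  rw [Finset.sum_range_one, pow_zero, one_mul] at htail
  have hterm (t : ℕ) :
      γ ^ t * (q t - γ * q (t + 1)) = γ ^ t * q t - γ ^ (t + 1) * q (t + 1) := by ring
  simp only [hterm]
  simpa only [sub_sub_cancel] using hsummable.hasSum.sub htail

theorem expectedReturn_eq {S A : ℕ} (R : Fin S → Fin A → Fin S → ℝ) (p₀ : stdSimplex ℝ (Fin S))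
    {γ : ℝ} (hγ0 : 0 ≤ γ) (hγ1 : γ < 1) (π : Policy S A) (P : Transition S A) :
    expectedReturn R p₀ γ π P = (p₀ : Fin S → ℝ) ⬝ᵥ policyValue R γ π P := by
  let q : Fin S × Fin A → ℝ := fun x => actionValue R γ P (policyValue R γ π P) x.1 x.2
  let r : (Fin S × Fin A) × (Fin S × Fin A) → ℝ := fun x => R x.1.1 x.1.2 x.2.1
  have hreturn := hasSum_pow_mul_integral hγ0 hγ1
    (fun t => integrable_trajectoryLaw p₀ π P r t (t + 1)) fun _ _ => norm_le_pi_norm r _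
  have hq (t : ℕ) : ‖∫ ω, q (ω t) ∂(trajectoryLaw p₀ π P)‖ ≤ ‖q‖ :=
    (norm_integral_le_of_norm_le_const (.of_forall fun _ => norm_le_pi_norm q _)).trans_eq
      (by rw [probReal_univ, mul_one])
  have hvalue := hasSum_pow_mul_sub_succ hγ0 hγ1 hq
  simp only [r, integral_trajectoryLaw_reward p₀ π P R hγ0 hγ1] at hreturn
  rw [expectedReturn, hreturn.unique hvalue, integral_trajectoryLaw_eval_zero]
  exact congrArg _ (funext fun s => (policyValue_bellman R hγ0 hγ1 π P s).symm)

/-! ### Dependence of the return on the transition function -/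

noncomputable section

variable {S A : ℕ} (R : Fin S → Fin A → Fin S → ℝ) (p₀ : stdSimplex ℝ (Fin S)) {γ : ℝ}

theorem sub_policyValue_eq (hγ0 : 0 ≤ γ) (hγ1 : γ < 1) (π : Policy S A) (P : Transition S A)
    (v : Fin S → ℝ) :
    v - policyValue R γ π P =
      (1 - γ • policyMatrix π P)⁻¹ *ᵥ
        fun s => v s - (π s : Fin A → ℝ) ⬝ᵥ actionValue R γ P v s := by
  have hresidual : (fun s => v s - (π s : Fin A → ℝ) ⬝ᵥ actionValue R γ P v s) =
      (1 - γ • policyMatrix π P) *ᵥ v - policyReward R π P := by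
    rw [Matrix.sub_mulVec, Matrix.one_mulVec, Matrix.smul_mulVec, sub_sub, add_comm,
      policyReward_add_smul_mulVec]
    rfl
  rw [hresidual, Matrix.mulVec_sub, Matrix.mulVec_mulVec,
    Matrix.nonsing_inv_mul _ (isUnit_det_one_sub_smul_policyMatrix hγ0 hγ1 π P),
    Matrix.one_mulVec, policyValue]

/-- The discounted occupancy measure `s ↦ ∑_t γ^t Pr[s_t = s]` of the states. -/
def occupancy (γ : ℝ) (π : Policy S A) (P : Transition S A) : Fin S → ℝ :=
  (p₀ : Fin S → ℝ) ᵥ* (1 - γ • policyMatrix π P)⁻¹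

theorem expectedReturn_sub_expectedReturn (hγ0 : 0 ≤ γ) (hγ1 : γ < 1) (π : Policy S A)
    (P Q : Transition S A) :
    expectedReturn R p₀ γ π P - expectedReturn R p₀ γ π Q =
      occupancy p₀ γ π Q ⬝ᵥ fun s => (π s : Fin A → ℝ) ⬝ᵥ fun a =>
        ((P s a : Fin S → ℝ) - (Q s a : Fin S → ℝ)) ⬝ᵥ
          oneStepValue R γ (policyValue R γ π P) s a := by
  rw [expectedReturn_eq R p₀ hγ0 hγ1, expectedReturn_eq R p₀ hγ0 hγ1, ← dotProduct_sub,
    sub_policyValue_eq R hγ0 hγ1, Matrix.dotProduct_mulVec, occupancy]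
  refine congrArg _ (funext fun s => ?_)
  rw [policyValue_bellman R hγ0 hγ1, ← dotProduct_sub]
  exact congrArg _ (funext fun a => (sub_dotProduct _ _ _).symm)

/-- The vector `c` with `ρ(π, P) - ρ(π, Pstar) = ⟨c, P - Pstar⟩`; it still depends on `P`, through
the value function. -/
def returnSlope (γ : ℝ) (Pstar : Transition S A) (π : Policy S A) (P : Transition S A) :
    EuclideanSpace ℝ (Fin S × Fin A × Fin S) :=
  WithLp.toLp 2 fun x => occupancy p₀ γ π Pstar x.1 * π x.1 x.2.1 *
    oneStepValue R γ (policyValue R γ π P) x.1 x.2.1 x.2.2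

theorem sqrt_mul_expectedReturn_sub (hγ0 : 0 ≤ γ) (hγ1 : γ < 1) (Pstar : Transition S A)
    (π : Policy S A) (P : Transition S A) (N : ℕ) :
    √(N : ℝ) * (expectedReturn R p₀ γ π P - expectedReturn R p₀ γ π Pstar) =
      inner ℝ (returnSlope R p₀ γ Pstar π P) (scaledDeviation Pstar N P) := by
  rw [expectedReturn_sub_expectedReturn R p₀ hγ0 hγ1, PiLp.inner_apply]
  simp only [returnSlope, scaledDeviation, dotProduct, Fintype.sum_prod_type, Finset.mul_sum,
    RCLike.inner_apply, conj_trivial]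
  refine Finset.sum_congr rfl fun s _ => Finset.sum_congr rfl fun a _ =>
    Finset.sum_congr rfl fun s' _ => ?_
  rw [Pi.sub_apply]
  ring

theorem continuous_policy_apply (s : Fin S) :
    Continuous fun π : Policy S A => (π s : Fin A → ℝ) :=
  continuous_subtype_val.comp (continuous_apply s)

theorem continuous_transition_apply (s : Fin S) (a : Fin A) :
    Continuous fun P : Transition S A => (P s a : Fin S → ℝ) :=
  continuous_subtype_val.comp (continuous_apply_apply s a)

theorem continuous_inv_one_sub_smul_policyMatrix (hγ0 : 0 ≤ γ) (hγ1 : γ < 1) :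
    Continuous fun x : Policy S A × Transition S A => (1 - γ • policyMatrix x.1 x.2)⁻¹ := by
  have hmatrix : Continuous fun x : Policy S A × Transition S A =>
      1 - γ • policyMatrix x.1 x.2 := by
    refine continuous_const.sub (Continuous.const_smul ?_ γ)
    refine continuous_matrix fun s s' => ?_
    simp only [policyMatrix, Matrix.of_apply]
    exact continuous_finsetSum _ fun a _ =>
      ((continuous_apply a).comp ((continuous_policy_apply s).comp continuous_fst)).mul
        ((continuous_apply s').comp ((continuous_transition_apply s a).comp continuous_snd))
  simp only [Matrix.inv_def, Ring.inverse_eq_inv']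
  exact (hmatrix.matrix_det.inv₀ fun x =>
    (isUnit_det_one_sub_smul_policyMatrix hγ0 hγ1 x.1 x.2).ne_zero).smul hmatrix.matrix_adjugate

theorem continuous_policyValue (hγ0 : 0 ≤ γ) (hγ1 : γ < 1) :
    Continuous fun x : Policy S A × Transition S A => policyValue R γ x.1 x.2 := by
  refine (continuous_inv_one_sub_smul_policyMatrix hγ0 hγ1).matrix_mulVec
    (continuous_pi fun s => ?_)
  exact ((continuous_policy_apply s).comp continuous_fst).dotProduct (continuous_pi fun a =>
    ((continuous_transition_apply s a).comp continuous_snd).dotProduct continuous_const)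

theorem continuous_expectedReturn (hγ0 : 0 ≤ γ) (hγ1 : γ < 1) :
    Continuous fun x : Policy S A × Transition S A => expectedReturn R p₀ γ x.1 x.2 := by
  simp only [expectedReturn_eq R p₀ hγ0 hγ1]
  exact continuous_const.dotProduct (continuous_policyValue R hγ0 hγ1)

theorem continuous_oneStepValue (γ : ℝ) (s : Fin S) (a : Fin A) :
    Continuous fun v => oneStepValue R γ v s a :=
  continuous_const.add (continuous_const_smul γ)

theorem continuous_returnSlope (hγ0 : 0 ≤ γ) (hγ1 : γ < 1) (Pstar : Transition S A) :
    Continuous fun x : Policy S A × Transition S A => returnSlope R p₀ γ Pstar x.1 x.2 := by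
  have hpair : Continuous fun x : Policy S A × Transition S A => (x.1, Pstar) :=
    continuous_fst.prodMk continuous_const
  have hinv := (continuous_inv_one_sub_smul_policyMatrix hγ0 hγ1).comp hpair
  have hoccupancy : Continuous fun x : Policy S A × Transition S A => occupancy p₀ γ x.1 Pstar :=
    continuous_const.matrix_vecMul hinv
  have hreward (s : Fin S) (a : Fin A) : Continuous fun x : Policy S A × Transition S A =>
      oneStepValue R γ (policyValue R γ x.1 x.2) s a :=
    (continuous_oneStepValue R γ s a).comp (continuous_policyValue R hγ0 hγ1)
  have hpolicy (s : Fin S) (a : Fin A) : Continuous fun x : Policy S A × Transition S A =>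
      (x.1 s : Fin A → ℝ) a :=
    (continuous_apply a).comp ((continuous_policy_apply s).comp continuous_fst)
  refine (PiLp.continuous_toLp 2 _).comp (continuous_pi fun y => ?_)
  exact (((continuous_pi_iff.1 hoccupancy) y.1).mul (hpolicy y.1 y.2.1)).mul
    (continuous_pi_iff.1 (hreward y.1 y.2.1) y.2.2)

end

/-! ### Optimal values -/

theorem contractingWith_iSup {ι κ : Type*} [Fintype ι] [Finite κ] [Nonempty κ] {γ : ℝ}
    (hγ0 : 0 ≤ γ) (hγ1 : γ < 1) {F : (ι → ℝ) → ι → κ → ℝ}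
    (hF : ∀ u v i j, dist (F u i j) (F v i j) ≤ γ * dist u v) :
    ContractingWith ⟨γ, hγ0⟩ fun u i => ⨆ j, F u i j :=
  ⟨NNReal.coe_lt_coe.1 hγ1, LipschitzWith.of_dist_le_mul fun u v =>
    (dist_pi_le_iff (mul_nonneg hγ0 dist_nonneg)).2 fun i => dist_iSup_le (hF u v i)⟩

noncomputable section

variable {S A : ℕ} (R : Fin S → Fin A → Fin S → ℝ) {γ : ℝ} {P : Transition S A} {v : Fin S → ℝ}

/-- The Bellman optimality operator `(T v)_s = max_a p_{s,a}ᵀ (r_{s,a} + γ v)` of `P`. -/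
def optimalBellman (γ : ℝ) (P : Transition S A) (v : Fin S → ℝ) : Fin S → ℝ :=
  fun s => ⨆ a, actionValue R γ P v s a

theorem dist_actionValue_le (hγ0 : 0 ≤ γ) (P : Transition S A) (u v : Fin S → ℝ) (s : Fin S)
    (a : Fin A) : dist (actionValue R γ P u s a) (actionValue R γ P v s a) ≤ γ * dist u v := by
  refine (dist_simplex_dotProduct_le (P s a) _ _).trans_eq ?_
  rw [oneStepValue, oneStepValue, dist_add_left, dist_smul₀, Real.norm_of_nonneg hγ0]

theorem contractingWith_optimalBellman [NeZero A] (hγ0 : 0 ≤ γ) (hγ1 : γ < 1)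
    (P : Transition S A) : ContractingWith ⟨γ, hγ0⟩ (optimalBellman R γ P) :=
  contractingWith_iSup hγ0 hγ1 (dist_actionValue_le R hγ0 P)

variable {R}

theorem actionValue_le_of_isFixedPt (hv : optimalBellman R γ P v = v) (s : Fin S) (a : Fin A) :
    actionValue R γ P v s a ≤ v s :=
  (le_ciSup (Set.finite_range _).bddAbove a).trans_eq (congrFun hv s)

theorem exists_actionValue_eq_of_isFixedPt [NeZero A] (hv : optimalBellman R γ P v = v)
    (s : Fin S) : ∃ a, actionValue R γ P v s a = v s := by
  obtain ⟨a, ha⟩ := exists_eq_ciSup_of_finite (f := actionValue R γ P v s)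
  exact ⟨a, ha.trans (congrFun hv s)⟩

theorem policyValue_le_of_isFixedPt (hγ0 : 0 ≤ γ) (hγ1 : γ < 1) (hv : optimalBellman R γ P v = v)
    (π : Policy S A) : policyValue R γ π P ≤ v := by
  intro s
  have : Nonempty (Fin S) := ⟨s⟩
  obtain ⟨s₀, hs₀⟩ := Finite.exists_max fun s => policyValue R γ π P s - v s
  set m := policyValue R γ π P s₀ - v s₀ with hm
  have haction (a : Fin A) : actionValue R γ P (policyValue R γ π P) s₀ a ≤ v s₀ + γ * m := by
    have hsub : (P s₀ a : Fin S → ℝ) ⬝ᵥ (policyValue R γ π P - v) ≤ m :=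
      simplex_dotProduct_le _ hs₀
    have hv₀ := actionValue_le_of_isFixedPt hv s₀ a
    rw [dotProduct_sub] at hsub
    rw [actionValue_eq_add] at hv₀ ⊢
    linarith [mul_le_mul_of_nonneg_left hsub hγ0]
  have hm_le : m ≤ γ * m := by
    rw [hm, sub_le_iff_le_add', ← hm, policyValue_bellman R hγ0 hγ1]
    exact simplex_dotProduct_le _ haction
  have hm0 : m ≤ 0 := by nlinarith
  linarith [hs₀ s]

theorem exists_policyValue_eq_of_isFixedPt [NeZero A] (hγ0 : 0 ≤ γ) (hγ1 : γ < 1)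
    (hv : optimalBellman R γ P v = v) : ∃ π : Policy S A, policyValue R γ π P = v := by
  choose f hf using exists_actionValue_eq_of_isFixedPt hv
  let π : Policy S A := fun s => ⟨Pi.single (f s) 1, single_mem_stdSimplex ℝ (f s)⟩
  refine ⟨π, ?_⟩
  have hresidual (s : Fin S) : v s - (π s : Fin A → ℝ) ⬝ᵥ actionValue R γ P v s = 0 :=
    sub_eq_zero.2 ((hf s).symm.trans (single_one_dotProduct _ _).symm)
  have hsub := sub_policyValue_eq R hγ0 hγ1 π P v
  simp only [hresidual] at hsub
  exact (sub_eq_zero.1 (hsub.trans (Matrix.mulVec_zero _))).symm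

end

/-! ### Bellman operators with penalized actions -/

noncomputable section

variable {S A : ℕ} (P : Transition S A) (γ : ℝ)

/-- The Bellman operator with reward `c`, where an action `a` in the state `s` is charged
`k * d s a`; the penalty rates `d s a ≤ 0` vanish exactly at the greedy actions. -/
def penalizedBellman (k : ℝ) (d c : Fin S → Fin A → ℝ) (u : Fin S → ℝ) : Fin S → ℝ :=
  fun s => ⨆ a, (k * d s a + (c s a + γ * ((P s a : Fin S → ℝ) ⬝ᵥ u)))

/-- The limit of `penalizedBellman` for `k → ∞`: only the actions with `d s a = 0` compete. -/
def greedyBellman (d c : Fin S → Fin A → ℝ) (u : Fin S → ℝ) : Fin S → ℝ :=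
  fun s => sSup ((fun a => c s a + γ * ((P s a : Fin S → ℝ) ⬝ᵥ u)) '' {a | d s a = 0})

variable {γ} {d c : Fin S → Fin A → ℝ}

theorem contractingWith_penalizedBellman [NeZero A] (hγ0 : 0 ≤ γ) (hγ1 : γ < 1) (k : ℝ)
    (d c : Fin S → Fin A → ℝ) : ContractingWith ⟨γ, hγ0⟩ (penalizedBellman P γ k d c) := by
  refine contractingWith_iSup hγ0 hγ1 fun u v s a => ?_
  rw [dist_add_left, dist_add_left, ← smul_eq_mul, ← smul_eq_mul, dist_smul₀,
    Real.norm_of_nonneg hγ0]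
  exact mul_le_mul_of_nonneg_left (dist_simplex_dotProduct_le (P s a) u v) hγ0

section Limit

variable {ι : Type*} {l : Filter ι} {k : ι → ℝ} {cs : ι → Fin S → Fin A → ℝ}

theorem tendsto_penalizedBellman (hk : Tendsto k l atTop) (hd0 : ∀ s a, d s a ≤ 0)
    (hdz : ∀ s, ∃ a, d s a = 0) (hc : ∀ s a, Tendsto (fun i => cs i s a) l (𝓝 (c s a)))
    (u : Fin S → ℝ) :
    Tendsto (fun i => penalizedBellman P γ (k i) d (cs i) u) l (𝓝 (greedyBellman P γ d c u)) :=
  tendsto_pi_nhds.2 fun s =>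
    tendsto_iSup_mul_add_of_finite hk (hd0 s) (hdz s) fun a => (hc s a).add_const _

theorem contractingWith_greedyBellman [NeZero A] (hγ0 : 0 ≤ γ) (hγ1 : γ < 1)
    (hd0 : ∀ s a, d s a ≤ 0) (hdz : ∀ s, ∃ a, d s a = 0) (c : Fin S → Fin A → ℝ) :
    ContractingWith ⟨γ, hγ0⟩ (greedyBellman P γ d c) := by
  have hlim := tendsto_penalizedBellman P (γ := γ) tendsto_natCast_atTop_atTop hd0 hdz
    (cs := fun _ => c) fun _ _ => tendsto_const_nhds
  exact ⟨hγ1, LipschitzWith.of_dist_le_mul fun u v =>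
    le_of_tendsto ((hlim u).dist (hlim v)) (.of_forall fun n =>
      (contractingWith_penalizedBellman P hγ0 hγ1 n d c).2.dist_le_mul u v)⟩

theorem exists_tendsto_penalizedBellman_fixedPoint [NeZero A] (hγ0 : 0 ≤ γ) (hγ1 : γ < 1)
    (hk : Tendsto k l atTop) (hd0 : ∀ s a, d s a ≤ 0) (hdz : ∀ s, ∃ a, d s a = 0)
    (hc : ∀ s a, Tendsto (fun i => cs i s a) l (𝓝 (c s a))) {us : ι → Fin S → ℝ}
    (hus : ∀ i, penalizedBellman P γ (k i) d (cs i) (us i) = us i) :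
    ∃ u, greedyBellman P γ d c u = u ∧ Tendsto us l (𝓝 u) := by
  have hgreedy := contractingWith_greedyBellman P hγ0 hγ1 hd0 hdz c
  have hfix : greedyBellman P γ d c hgreedy.fixedPoint = hgreedy.fixedPoint :=
    hgreedy.fixedPoint_isFixedPt
  refine ⟨_, hfix, tendsto_fixedPoint
    (fun i => contractingWith_penalizedBellman P hγ0 hγ1 (k i) d (cs i)) hus ?_⟩
  have hlim := tendsto_penalizedBellman P (γ := γ) hk hd0 hdz hc hgreedy.fixedPoint
  rwa [hfix] at hlim

end Limit

theorem div_le_of_isFixedPt_greedyBellman (hγ0 : 0 ≤ γ) (hγ1 : γ < 1)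
    (hdz : ∀ s, ∃ a, d s a = 0) {m : ℝ} (hm : ∀ s a, m ≤ c s a) {u : Fin S → ℝ}
    (hu : greedyBellman P γ d c u = u) (s : Fin S) : m / (1 - γ) ≤ u s := by
  have : Nonempty (Fin S) := ⟨s⟩
  obtain ⟨s₀, hs₀⟩ := Finite.exists_min u
  obtain ⟨a, ha⟩ := hdz s₀
  have hle : c s₀ a + γ * ((P s₀ a : Fin S → ℝ) ⬝ᵥ u) ≤ u s₀ := by
    rw [← congrFun hu s₀]
    exact le_csSup (Set.toFinite _).bddAbove ⟨a, ha, rfl⟩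
  have hmin : u s₀ ≤ (P s₀ a : Fin S → ℝ) ⬝ᵥ u := le_simplex_dotProduct _ hs₀
  refine le_trans ?_ (hs₀ s)
  rw [div_le_iff₀ (sub_pos.2 hγ1)]
  linarith [hm s₀ a, mul_le_mul_of_nonneg_left hmin hγ0]

end

/-! ### The VaR Bellman operator -/

noncomputable section

theorem continuous_iSup_of_finite {ι : Type*} [Finite ι] [Nonempty ι] :
    Continuous fun f : ι → ℝ => ⨆ i, f i := by
  have := Fintype.ofFinite ι
  simp only [← Finset.sup'_univ_eq_ciSup]
  exact Continuous.finset_sup'_apply _ fun i _ => continuous_apply i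

variable {S A : ℕ} (R : Fin S → Fin A → Fin S → ℝ) {γ : ℝ}

theorem isBounded_range_actionValue (γ : ℝ) (v : Fin S → ℝ) (s : Fin S) (a : Fin A) :
    Bornology.IsBounded (Set.range fun P : Transition S A => actionValue R γ P v s a) :=
  (isCompact_range ((continuous_transition_apply s a).dotProduct continuous_const)).isBounded

theorem contractingWith_varBellman [NeZero A] (hγ0 : 0 ≤ γ) (hγ1 : γ < 1)
    (μ : Measure (Transition S A)) [IsProbabilityMeasure μ] {α : ℝ} (hα0 : 0 ≤ α) (hα1 : α < 1) :
    ContractingWith ⟨γ, hγ0⟩ (varBellman R γ μ α) :=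
  contractingWith_iSup hγ0 hγ1 fun u v s a =>
    dist_valueAtRisk_le hα0 hα1 (isBounded_range_actionValue R γ u s a)
      (isBounded_range_actionValue R γ v s a) fun P => dist_actionValue_le R hγ0 P u v s a

/-- The vector with entries `w` in the block of `(s, a)` and zeros elsewhere. -/
def blockVector (s : Fin S) (a : Fin A) (w : Fin S → ℝ) :
    EuclideanSpace ℝ (Fin S × Fin A × Fin S) :=
  WithLp.toLp 2 fun x => if x.1 = s then if x.2.1 = a then w x.2.2 else 0 else 0

theorem continuous_blockVector (s : Fin S) (a : Fin A) : Continuous (blockVector s a) := by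
  refine (PiLp.continuous_toLp 2 _).comp (continuous_pi fun x => ?_)
  split_ifs
  · exact continuous_apply _
  · exact continuous_const
  · exact continuous_const

theorem dotProduct_blockVector (f : Fin S × Fin A × Fin S → ℝ) (s : Fin S) (a : Fin A)
    (w : Fin S → ℝ) : f ⬝ᵥ (blockVector s a w).ofLp = (fun s' => f (s, a, s')) ⬝ᵥ w := by
  simp only [blockVector, dotProduct, Fintype.sum_prod_type, mul_ite, mul_zero]
  rw [Finset.sum_eq_single s (by simp +contextual) (by simp),
    Finset.sum_eq_single a (by simp +contextual) (by simp)]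
  simp only [if_true]

theorem blockVector_dotProduct_mulVec
    (C : Matrix (Fin S × Fin A × Fin S) (Fin S × Fin A × Fin S) ℝ) (s : Fin S) (a : Fin A)
    (w : Fin S → ℝ) :
    (blockVector s a w).ofLp ⬝ᵥ C *ᵥ (blockVector s a w).ofLp = w ⬝ᵥ covBlock C s a *ᵥ w := by
  rw [dotProduct_comm, dotProduct_blockVector, dotProduct_comm]
  exact congrArg _ (funext fun s' => dotProduct_blockVector _ s a w)

theorem sqrt_mul_actionValue_sub (γ : ℝ) (Pstar P : Transition S A) (v : Fin S → ℝ) (N : ℕ)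
    (s : Fin S) (a : Fin A) :
    √(N : ℝ) * (actionValue R γ P v s a - actionValue R γ Pstar v s a) =
      inner ℝ (blockVector s a (oneStepValue R γ v s a)) (scaledDeviation Pstar N P) := by
  rw [EuclideanSpace.inner_eq_star_dotProduct, star_trivial, dotProduct_blockVector, actionValue,
    actionValue, ← sub_dotProduct, ← smul_eq_mul, ← smul_dotProduct]
  rfl

theorem penalizedBellman_smul_sub [NeZero A] {μ : Measure (Transition S A)} {α : ℝ}
    {v : Fin S → ℝ} (hv : varBellman R γ μ α v = v) (P : Transition S A) (u : Fin S → ℝ) {k : ℝ}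
    (hk : 0 ≤ k) :
    penalizedBellman P γ k (fun s a => actionValue R γ P u s a - u s)
      (fun s a => k * (valueAtRisk μ α (fun Q => actionValue R γ Q v s a) -
        actionValue R γ P v s a)) (k • (v - u)) = k • (v - u) := by
  ext s
  have hvs : (⨆ a, valueAtRisk μ α fun Q => actionValue R γ Q v s a) = v s := congrFun hv s
  rw [Pi.smul_apply, Pi.sub_apply, smul_eq_mul, ← hvs,
    mul_iSup_sub (Set.finite_range _).bddAbove hk, penalizedBellman]
  refine congrArg _ (funext fun a => ?_)
  rw [dotProduct_smul, dotProduct_sub, actionValue_eq_add R γ P, actionValue_eq_add R γ P,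
    smul_eq_mul]
  ring

theorem sqrt_dotProduct_covBlock_mulVec_le_sigmaMax
    (C : Matrix (Fin S × Fin A × Fin S) (Fin S × Fin A × Fin S) ℝ) (γ : ℝ) (v : Fin S → ℝ)
    (s : Fin S) (a : Fin A) :
    √(oneStepValue R γ v s a ⬝ᵥ covBlock C s a *ᵥ oneStepValue R γ v s a) ≤
      sigmaMax R γ C v :=
  Real.sqrt_le_sqrt (le_ciSup (f := fun x : Fin S × Fin A => oneStepValue R γ v x.1 x.2 ⬝ᵥ
    (covBlock C x.1 x.2 *ᵥ oneStepValue R γ v x.1 x.2)) (Set.finite_range _).bddAbove (s, a))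

theorem continuous_sigmaMax [NeZero S] [NeZero A] (γ : ℝ)
    (C : Matrix (Fin S × Fin A × Fin S) (Fin S × Fin A × Fin S) ℝ) :
    Continuous (sigmaMax R γ C) :=
  Real.continuous_sqrt.comp (continuous_iSup_of_finite.comp (continuous_pi fun x =>
    (continuous_oneStepValue R γ x.1 x.2).dotProduct
      (continuous_const.matrix_mulVec (continuous_oneStepValue R γ x.1 x.2))))

theorem tendsto_of_tendsto_mul_sub {ι : Type*} {l : Filter ι} {k f : ι → ℝ} {b L : ℝ}
    (hk : Tendsto k l atTop) (h : Tendsto (fun i => k i * (f i - b)) l (𝓝 L)) :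
    Tendsto f l (𝓝 b) := by
  have hsub := (hk.inv_tendsto_atTop.mul h).add_const b
  rw [zero_mul, zero_add] at hsub
  refine hsub.congr' ?_
  filter_upwards [hk.eventually_gt_atTop 0] with i hi
  rw [Pi.inv_apply, inv_mul_cancel_left₀ hi.ne', sub_add_cancel]

variable {Pstar : Transition S A} {post : ℕ → Measure (Transition S A)}
  [∀ N, IsProbabilityMeasure (post N)]
  {C : Matrix (Fin S × Fin A × Fin S) (Fin S × Fin A × Fin S) ℝ} {α : ℝ} {vstar : Fin S → ℝ}
  {vhat : ℕ → Fin S → ℝ}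

theorem tendsto_sqrt_mul_valueAtRisk_actionValue_sub (hC : C.PosSemidef)
    (hnormal : AsymptoticallyNormal Pstar post C) (hα0 : 0 < α) (hα1 : α < 1)
    (hvhat : Tendsto vhat atTop (𝓝 vstar)) (s : Fin S) (a : Fin A) :
    Tendsto (fun N : ℕ => √(N : ℝ) *
      (valueAtRisk (post N) α (fun P => actionValue R γ P (vhat N) s a) -
        actionValue R γ Pstar (vhat N) s a)) atTop
      (𝓝 (-stdNormalQuantile (1 - α) *
        √(oneStepValue R γ vstar s a ⬝ᵥ covBlock C s a *ᵥ oneStepValue R γ vstar s a))) := by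
  rw [← blockVector_dotProduct_mulVec]
  have hblock : Continuous fun v => blockVector s a (oneStepValue R γ v s a) :=
    (continuous_blockVector s a).comp (continuous_oneStepValue R γ s a)
  exact tendsto_sqrt_mul_valueAtRisk_sub hC hnormal tendsto_id hα0 hα1
    (((hblock.tendsto vstar).comp hvhat).comp tendsto_fst)
    fun N P => sqrt_mul_actionValue_sub R γ Pstar P (vhat N) N s a

theorem tendsto_varBellman_fixedPoint [NeZero A] (hγ0 : 0 ≤ γ) (hγ1 : γ < 1) (hC : C.PosSemidef)
    (hnormal : AsymptoticallyNormal Pstar post C) (hα0 : 0 < α) (hα1 : α < 1)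
    (hvstar : optimalBellman R γ Pstar vstar = vstar)
    (hvhat : ∀ N, varBellman R γ (post N) α (vhat N) = vhat N) :
    Tendsto vhat atTop (𝓝 vstar) := by
  refine tendsto_fixedPoint
    (fun N => contractingWith_varBellman R hγ0 hγ1 (post N) hα0.le hα1) hvhat ?_
  have hvar (s : Fin S) (a : Fin A) :
      Tendsto (fun N => valueAtRisk (post N) α fun P => actionValue R γ P vstar s a) atTop
        (𝓝 (actionValue R γ Pstar vstar s a)) :=
    tendsto_of_tendsto_mul_sub tendsto_sqrt_natCast_atTop
      (tendsto_sqrt_mul_valueAtRisk_actionValue_sub R hC hnormal hα0 hα1 tendsto_const_nhds s a)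
  have hbellman : Tendsto (fun N => varBellman R γ (post N) α vstar) atTop
      (𝓝 (optimalBellman R γ Pstar vstar)) :=
    tendsto_pi_nhds.2 fun s =>
      (continuous_iSup_of_finite.tendsto _).comp (tendsto_pi_nhds.2 (hvar s))
  rwa [hvstar] at hbellman

theorem exists_tendsto_sqrt_smul_varBellman_fixedPoint_sub [NeZero A] (hγ0 : 0 ≤ γ) (hγ1 : γ < 1)
    (hC : C.PosSemidef) (hnormal : AsymptoticallyNormal Pstar post C) (hα0 : 0 < α)
    (hα1 : α ≤ 1 / 2) (hvstar : optimalBellman R γ Pstar vstar = vstar)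
    (hvhat : ∀ N, varBellman R γ (post N) α (vhat N) = vhat N) :
    ∃ u : Fin S → ℝ, Tendsto (fun N : ℕ => √(N : ℝ) • (vhat N - vstar)) atTop (𝓝 u) ∧
      ∀ s, -(stdNormalQuantile (1 - α) * sigmaMax R γ C vstar) / (1 - γ) ≤ u s := by
  have hlim := tendsto_varBellman_fixedPoint R hγ0 hγ1 hC hnormal hα0 (by linarith) hvstar hvhat
  have hgreedy (s : Fin S) : ∃ a, actionValue R γ Pstar vstar s a - vstar s = 0 :=
    (exists_actionValue_eq_of_isFixedPt hvstar s).imp fun _ => sub_eq_zero.2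
  obtain ⟨u, hu, hlimu⟩ := exists_tendsto_penalizedBellman_fixedPoint Pstar hγ0 hγ1
    tendsto_sqrt_natCast_atTop
    (fun s a => sub_nonpos.2 (actionValue_le_of_isFixedPt hvstar s a)) hgreedy
    (tendsto_sqrt_mul_valueAtRisk_actionValue_sub R hC hnormal hα0 (by linarith) hlim)
    fun N => penalizedBellman_smul_sub R (hvhat N) Pstar vstar (Real.sqrt_nonneg N)
  refine ⟨u, hlimu, div_le_of_isFixedPt_greedyBellman Pstar hγ0 hγ1 hgreedy (fun s a => ?_) hu⟩
  rw [neg_mul]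
  exact neg_le_neg (mul_le_mul_of_nonneg_left
    (sqrt_dotProduct_covBlock_mulVec_le_sigmaMax R C γ vstar s a)
    (stdNormalQuantile_nonneg (by linarith)))

end

/-! ### The optimal percentile return -/

section

variable {S A : ℕ} (R : Fin S → Fin A → Fin S → ℝ) (p₀ : stdSimplex ℝ (Fin S)) {γ : ℝ}

theorem bddAbove_range_valueAtRisk_expectedReturn (hγ0 : 0 ≤ γ) (hγ1 : γ < 1)
    (μ : Measure (Transition S A)) [IsProbabilityMeasure μ] {δ : ℝ} (hδ0 : 0 ≤ δ) (hδ1 : δ < 1) :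
    BddAbove (Set.range fun π : Policy S A => valueAtRisk μ δ (expectedReturn R p₀ γ π)) := by
  have hrange := isCompact_range (continuous_expectedReturn (A := A) R p₀ hγ0 hγ1)
  obtain ⟨B, hB⟩ := hrange.bddAbove
  refine ⟨B, Set.forall_mem_range.2 fun π => valueAtRisk_le hδ0 hδ1
    (hrange.bddBelow.mono (Set.range_subset_iff.2 fun P => ?_)) fun P => ?_⟩
  · exact ⟨(π, P), rfl⟩
  · exact hB ⟨(π, P), rfl⟩

theorem mul_optimalPercentileReturn_sub [NeZero A] (hγ0 : 0 ≤ γ) (hγ1 : γ < 1)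
    (μ : Measure (Transition S A)) [IsProbabilityMeasure μ] {δ : ℝ} (hδ0 : 0 ≤ δ) (hδ1 : δ < 1)
    (Pstar : Transition S A) (b : ℝ) {k : ℝ} (hk : 0 ≤ k) :
    k * (optimalPercentileReturn R p₀ γ μ δ - b) =
      ⨆ π : Policy S A, (k * (expectedReturn R p₀ γ π Pstar - b) +
        k * (valueAtRisk μ δ (expectedReturn R p₀ γ π) - expectedReturn R p₀ γ π Pstar)) := by
  rw [optimalPercentileReturn,
    mul_iSup_sub (bddAbove_range_valueAtRisk_expectedReturn R p₀ hγ0 hγ1 μ hδ0 hδ1) hk]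
  refine congrArg _ (funext fun π => ?_)
  ring

variable {Pstar : Transition S A} {post : ℕ → Measure (Transition S A)}
  [∀ N, IsProbabilityMeasure (post N)]
  {C : Matrix (Fin S × Fin A × Fin S) (Fin S × Fin A × Fin S) ℝ} {δ : ℝ}

theorem tendsto_sqrt_mul_valueAtRisk_expectedReturn_sub (hγ0 : 0 ≤ γ) (hγ1 : γ < 1)
    (hC : C.PosSemidef) (hnormal : AsymptoticallyNormal Pstar post C) (hδ0 : 0 < δ) (hδ1 : δ < 1)
    (π : Policy S A) :
    Tendsto (fun x : ℕ × Policy S A => √(x.1 : ℝ) *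
      (valueAtRisk (post x.1) δ (expectedReturn R p₀ γ x.2) - expectedReturn R p₀ γ x.2 Pstar))
      (atTop ×ˢ 𝓝 π) (𝓝 (-stdNormalQuantile (1 - δ) *
        √((returnSlope R p₀ γ Pstar π Pstar).ofLp ⬝ᵥ
          C *ᵥ (returnSlope R p₀ γ Pstar π Pstar).ofLp))) := by
  have hslope := (continuous_returnSlope R p₀ hγ0 hγ1 Pstar).tendsto (π, Pstar)
  rw [nhds_prod_eq] at hslope
  exact tendsto_sqrt_mul_valueAtRisk_sub hC hnormal tendsto_fst hδ0 hδ1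
    (hslope.comp ((tendsto_snd.comp tendsto_fst).prodMk tendsto_snd))
    fun x P => sqrt_mul_expectedReturn_sub R p₀ hγ0 hγ1 Pstar x.2 P x.1

theorem exists_tendsto_sqrt_mul_optimalPercentileReturn_sub [NeZero A] (hγ0 : 0 ≤ γ)
    (hγ1 : γ < 1) (hC : C.PosSemidef) (hnormal : AsymptoticallyNormal Pstar post C) (hδ0 : 0 < δ)
    (hδ1 : δ ≤ 1 / 2) {vstar : Fin S → ℝ} (hvstar : optimalBellman R γ Pstar vstar = vstar) :
    ∃ L ≤ 0, Tendsto (fun N : ℕ => √(N : ℝ) *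
      (optimalPercentileReturn R p₀ γ (post N) δ - (p₀ : Fin S → ℝ) ⬝ᵥ vstar)) atTop (𝓝 L) := by
  have hδ : δ < 1 := by linarith
  obtain ⟨πstar, hπstar⟩ := exists_policyValue_eq_of_isFixedPt hγ0 hγ1 hvstar
  have hnonpos (π : Policy S A) : -stdNormalQuantile (1 - δ) *
      √((returnSlope R p₀ γ Pstar π Pstar).ofLp ⬝ᵥ
        C *ᵥ (returnSlope R p₀ γ Pstar π Pstar).ofLp) ≤ 0 :=
    mul_nonpos_of_nonpos_of_nonneg
      (neg_nonpos.2 (stdNormalQuantile_nonneg (by linarith))) (Real.sqrt_nonneg _)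
  have hpair : Continuous fun π : Policy S A => (π, Pstar) :=
    continuous_id.prodMk continuous_const
  have hcont := (continuous_expectedReturn R p₀ hγ0 hγ1).comp hpair
  simp only [fun N : ℕ => mul_optimalPercentileReturn_sub R p₀ hγ0 hγ1 (post N) hδ0.le hδ Pstar
    ((p₀ : Fin S → ℝ) ⬝ᵥ vstar) (Real.sqrt_nonneg N)]
  refine ⟨_, Real.sSup_nonpos (Set.forall_mem_image.2 fun π _ => hnonpos π),
    tendsto_iSup_mul_add (d := fun π => expectedReturn R p₀ γ π Pstar - (p₀ : Fin S → ℝ) ⬝ᵥ vstar)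
      tendsto_sqrt_natCast_atTop (hcont.sub continuous_const) (fun π => ?_) ⟨πstar, ?_⟩
      (tendsto_sqrt_mul_valueAtRisk_expectedReturn_sub R p₀ hγ0 hγ1 hC hnormal hδ0 hδ)
      (fun N => ?_) ⟨0, Set.forall_mem_image.2 fun π _ => hnonpos π⟩⟩
  · rw [sub_nonpos, expectedReturn_eq R p₀ hγ0 hγ1]
    exact simplex_dotProduct_mono p₀ (policyValue_le_of_isFixedPt hγ0 hγ1 hvstar π)
  · rw [expectedReturn_eq R p₀ hγ0 hγ1, hπstar, sub_self]
  · obtain ⟨B, hB⟩ :=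
      bddAbove_range_valueAtRisk_expectedReturn R p₀ hγ0 hγ1 (post N) hδ0.le hδ
    refine ⟨√(N : ℝ) * (B - (p₀ : Fin S → ℝ) ⬝ᵥ vstar), Set.forall_mem_range.2 fun π => ?_⟩
    linarith [mul_le_mul_of_nonneg_left (hB ⟨π, rfl⟩) (Real.sqrt_nonneg (N : ℝ))]

end

/-! ### Performance of the VaR Bellman operator -/

theorem two_mul_stdNormalQuantile_one_sub_div_le {δ n : ℝ} (hδ0 : 0 < δ) (hδn : δ < n) :
    2 * stdNormalQuantile (1 - δ / n) ≤ √(8 * Real.log (n / δ)) := by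
  have hn : 0 < n := hδ0.trans hδn
  have hquantile := stdNormalQuantile_le_sqrt_log (div_pos hδ0 hn) ((div_lt_one hn).2 hδn)
  rw [one_div_div] at hquantile
  calc 2 * stdNormalQuantile (1 - δ / n) ≤ 2 * √(2 * Real.log (n / δ)) := by gcongr
    _ = √(2 ^ 2 * (2 * Real.log (n / δ))) := by
      rw [Real.sqrt_mul (sq_nonneg 2), Real.sqrt_sq zero_le_two]
    _ = √(8 * Real.log (n / δ)) := by ring_nf

theorem pos_of_mem_stdSimplex {n : ℕ} (p : stdSimplex ℝ (Fin n)) : 0 < n := by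
  refine Nat.pos_of_ne_zero ?_
  rintro rfl
  simpa using stdSimplex.sum_eq_one p

theorem theorem3p5_general {S A : ℕ} (hA : 0 < A) (R : Fin S → Fin A → Fin S → ℝ)
    (p₀ : stdSimplex ℝ (Fin S)) {γ : ℝ} (hγ0 : 0 ≤ γ) (hγ1 : γ < 1) {δ : ℝ} (hδ0 : 0 < δ)
    (hδ1 : δ ≤ 1 / 2) {α : ℝ} (hα0 : 0 < α) (hα1 : α ≤ 1 / 2) {Pstar : Transition S A}
    {post : ℕ → Measure (Transition S A)} [∀ N, IsProbabilityMeasure (post N)]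
    {C : Matrix (Fin S × Fin A × Fin S) (Fin S × Fin A × Fin S) ℝ} (hC : C.PosSemidef)
    (hnormal : AsymptoticallyNormal Pstar post C) :
    ∃ vhat : ℕ → Fin S → ℝ, (∀ N v, varBellman R γ (post N) α v = v ↔ v = vhat N) ∧
      ∃ σ L : ℝ, 0 ≤ σ ∧
        Tendsto (fun N => sigmaMax R γ C (vhat N)) atTop (𝓝 σ) ∧
        Tendsto (fun N : ℕ => √(N : ℝ) *
          (optimalPercentileReturn R p₀ γ (post N) δ - (p₀ : Fin S → ℝ) ⬝ᵥ vhat N))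
          atTop (𝓝 L) ∧
        L ≤ 1 / (1 - γ) * (stdNormalQuantile (1 - α) * σ) := by
  have : NeZero A := ⟨hA.ne'⟩
  have : NeZero S := ⟨(pos_of_mem_stdSimplex p₀).ne'⟩
  have hvar (N : ℕ) := contractingWith_varBellman R hγ0 hγ1 (post N) hα0.le (by linarith)
  have hfix (N : ℕ) := (hvar N).fixedPoint_isFixedPt
  have hopt := (contractingWith_optimalBellman R hγ0 hγ1 Pstar).fixedPoint_isFixedPt
  have hvhat := tendsto_varBellman_fixedPoint R hγ0 hγ1 hC hnormal hα0 (by linarith) hopt hfix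
  obtain ⟨u, hu, hle⟩ :=
    exists_tendsto_sqrt_smul_varBellman_fixedPoint_sub R hγ0 hγ1 hC hnormal hα0 hα1 hopt hfix
  obtain ⟨L, hL0, hL⟩ := exists_tendsto_sqrt_mul_optimalPercentileReturn_sub R p₀ hγ0 hγ1 hC
    hnormal hδ0 hδ1 hopt
  refine ⟨_, fun N v => isFixedPt_iff_eq_fixedPoint (hvar N), _, L - (p₀ : Fin S → ℝ) ⬝ᵥ u,
    Real.sqrt_nonneg _, ((continuous_sigmaMax R γ C).tendsto _).comp hvhat, ?_, ?_⟩
  · have hdot : Continuous fun v => (p₀ : Fin S → ℝ) ⬝ᵥ v :=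
      continuous_const.dotProduct continuous_id
    refine (hL.sub ((hdot.tendsto u).comp hu)).congr fun N => ?_
    rw [Function.comp_apply, dotProduct_smul, dotProduct_sub, smul_eq_mul]
    ring
  · have hdot_le := le_simplex_dotProduct p₀ hle
    rw [neg_div, div_eq_mul_one_div, mul_comm] at hdot_le
    linarith!

theorem theorem3p5 {S A : ℕ} (hA : 0 < A)
    (R : Fin S → Fin A → Fin S → ℝ) (p₀ : stdSimplex ℝ (Fin S))
    (γ : ℝ) (hγ0 : 0 ≤ γ) (hγ1 : γ < 1)
    (δ : ℝ) (hδ0 : 0 < δ) (hδ1 : δ < 1 / 2)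
    (Pstar : Transition S A)
    -- the posterior law of the transition function after `N` observations
    (post : ℕ → Measure (Transition S A)) [∀ N, IsProbabilityMeasure (post N)]
    -- its asymptotic covariance matrix, the (possibly degenerate) inverse Fisher information
    (C : Matrix (Fin S × Fin A × Fin S) (Fin S × Fin A × Fin S) ℝ) (hC : C.PosSemidef)
    (hnormal : TendstoInDistribution (fun N => scaledDeviation Pstar N) atTop
      (id : EuclideanSpace ℝ (Fin S × Fin A × Fin S) → _) post (multivariateGaussian 0 C)) :
    ∃ vhat : ℕ → Fin S → ℝ,
      (∀ N v, varBellman R γ (post N) (δ / S) v = v ↔ v = vhat N) ∧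
      ∃ σ L : ℝ,
        Tendsto (fun N => sigmaMax R γ C (vhat N)) atTop (𝓝 σ) ∧
        Tendsto (fun N : ℕ => √(N : ℝ) *
          (optimalPercentileReturn R p₀ γ (post N) δ - (p₀ : Fin S → ℝ) ⬝ᵥ vhat N))
          atTop (𝓝 L) ∧
        L ≤ 1 / (1 - γ) * (2 * stdNormalQuantile (1 - δ / S) * σ) ∧
        1 / (1 - γ) * (2 * stdNormalQuantile (1 - δ / S) * σ) ≤
          1 / (1 - γ) * (√(8 * Real.log (S / δ)) * σ) := by
  have hS : (1 : ℝ) ≤ S := Nat.one_le_cast.2 (pos_of_mem_stdSimplex p₀)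
  have hα0 : 0 < δ / S := by positivity
  have hα1 : δ / S ≤ 1 / 2 := (div_le_self hδ0.le hS).trans hδ1.le
  obtain ⟨vhat, hfix, σ, L, hσ0, hσ, hL, hbound⟩ :=
    theorem3p5_general hA R p₀ hγ0 hγ1 hδ0 hδ1.le hα0 hα1 hC hnormal
  have hz : 0 ≤ stdNormalQuantile (1 - δ / S) := stdNormalQuantile_nonneg (by linarith)
  have _ : 0 ≤ 1 / (1 - γ) := one_div_nonneg.2 (sub_nonneg.2 hγ1.le)
  refine ⟨vhat, hfix, σ, L, hσ, hL, hbound.trans ?_, ?_⟩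
  · gcongr
    linarith
  · gcongr
    exact two_mul_stdNormalQuantile_one_sub_div_le hδ0 (by linarith)
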